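/- Let $Y_0,\dots,Y_{n-1}$ ($n\ge 1$) be independent continuous-time symmetric simple random walks on $\mathbb{Z}$ started at $0$, with càdlàg paths and transition probabilities $p_t(x,y)=p_t(y-x)$, where $$p_t(k)=e^{-t}\sum_{m\in\mathbb{Z}}\frac{(t/2)^{2m+k}}{m!\,(m+k)!},\qquad k\in\mathbb{Z},\qquad \tfrac1{j!}:=0 \text{ for } j<0.$$ Let $X_i(t)=Y_i(t)+i$ for $i=0,\dots,n-1$, and let $T\ge 0$. Let $\mathbb{P}$ denote the probability conditioned on the event that $X_i(T)=X_i(0)$ for all $i$ and $X_0(t)<X_1(t)<\cdots<X_{n-1}(t)$ for all $t\in[0,T]$ (this event has positive probability). Define the width $$W_n(T)=\sup_{t\in[0,T]}\bigl(X_{n-1}(t)-X_0(t)\bigr).$$ For a function $f$ that is continuous on the unit circle and a finite nonempty subset $\mathcal{D}$ of the unit circle put $$\mathcal{T}_n(f)=\det\Bigl[\oint_{|z|=1}z^{-j+k}f(z)\frac{dz}{2\pi i z}\Bigr]_{j,k=0}^{n-1},\qquad \mathbf{T}_n(f,\mathcal{D})=\det\Bigl[\frac1{|\mathcal{D}|}\sum_{z\in\mathcal{D}}z^{-j+k}f(z)\Bigr]_{j,k=0}^{n-1}.$$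 Then, with $f(z)=e^{\frac T2(z+z^{-1})}$ and $\mathcal{D}_s=\{z\in\mathbb{C}:z^M=s\}$, for every integer $M\ge 1$ one has $\mathcal{T}_n(f)\neq 0$, the function $s\mapsto \mathbf{T}_n(f,\mathcal{D}_s)/(2\pi i s)$ is integrable on $|s|=1$, and $$\mathbb{P}(W_n(T)<M)=\frac1{\mathcal{T}_n(f)}\oint_{|s|=1}\mathbf{T}_n(f,\mathcal{D}_s)\,\frac{ds}{2\pi i s}.$$ -/

import Mathlib

open MeasureTheory ProbabilityTheory Filter Topology
open scoped NNReal

noncomputable section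

/-! ### Toeplitz determinants -/

/-- The discrete Toeplitz determinant of `f` on a finite set `D ⊆ ℂ`:
`det [ |D|⁻¹ ∑_{z ∈ D} z^{-j+k} f(z) ]_{j,k=0}^{n-1}`. -/
def discreteToeplitz (n : ℕ) (f : ℂ → ℂ) (D : Finset ℂ) : ℂ :=
  Matrix.det (Matrix.of fun j k : Fin n =>
    (1 / (D.card : ℂ)) * ∑ z ∈ D, z ^ (-(j : ℤ) + (k : ℤ)) * f z)

/-- The continuous Toeplitz determinant of the symbol `f`:
`det [ ∮_{|z|=1} z^{-j+k} f(z) dz/(2πiz) ]_{j,k=0}^{n-1}`. -/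
def continuousToeplitz (n : ℕ) (f : ℂ → ℂ) : ℂ :=
  Matrix.det (Matrix.of fun j k : Fin n =>
    ∮ z in C(0, 1), z ^ (-(j : ℤ) + (k : ℤ)) * f z / (2 * Real.pi * Complex.I * z))

/-- The symbol `f(z) = exp (T/2 (z + z⁻¹))`. -/
def walkSymbol (T : ℝ≥0) (z : ℂ) : ℂ :=
  Complex.exp (((T : ℝ) : ℂ) / 2 * (z + z⁻¹))

/-- The finite set `{z ∈ ℂ : z ^ M = s}`, for `M ≥ 1`. -/
def rootSet (M : ℕ) (s : ℂ) : Finset ℂ :=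
  Polynomial.nthRootsFinset M s

theorem mem_rootSet {M : ℕ} (hM : 0 < M) {s z : ℂ} : z ∈ rootSet M s ↔ z ^ M = s :=
  Polynomial.mem_nthRootsFinset hM s

/-! ### Continuous-time symmetric simple random walk -/

/-- `1 / k!` for an integer `k`, with the convention `1 / k! = 0` for `k < 0`. -/
def invFactorial (k : ℤ) : ℝ :=
  if k < 0 then 0 else 1 / (k.toNat.factorial : ℝ)

/-- The transition probability
`p_t(k) = e^{-t} ∑_{m ∈ ℤ} (t/2)^{2m+k} / (m! (m+k)!)` of the continuous-time symmetric simple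
random walk (jumps `+1` and `-1`, each at rate `1/2`). -/
def walkKernel (t : ℝ≥0) (k : ℤ) : ℝ :=
  Real.exp (-(t : ℝ)) *
    ∑' m : ℤ, ((t : ℝ) / 2) ^ (2 * m + k) * (invFactorial m * invFactorial (m + k))

/-- `Y` is a continuous-time symmetric simple random walk on `ℤ` started at `0`: it has
independent increments, `Y t - Y s` has law `p_{t-s}`, and its paths are almost surely càdlàg. -/
structure IsSymmetricWalk {Ω : Type*} [MeasurableSpace Ω] (μ : Measure Ω)
    (Y : ℝ≥0 → Ω → ℤ) : Prop where
  measurable : ∀ t, Measurable (Y t)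
  start_zero : ∀ᵐ ω ∂μ, Y 0 ω = 0
  indep_increments : HasIndepIncrements Y μ
  law_increment : ∀ s t : ℝ≥0, s ≤ t → ∀ k : ℤ,
    μ {ω | Y t ω - Y s ω = k} = ENNReal.ofReal (walkKernel (t - s) k)
  cadlag : ∀ᵐ ω ∂μ, ∀ t : ℝ≥0,
    ContinuousWithinAt (fun u => Y u ω) (Set.Ici t) t ∧
      ∃ l : ℤ, Tendsto (fun u => Y u ω) (𝓝[<] t) (𝓝 l)

/-! ### Non-intersecting walks and their width -/

/-- The position `X_i(t) = Y_i(t) + i` of the `i`-th walker, `i = 0, …, n - 1`. -/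
def walker {Ω : Type*} {n : ℕ} (Y : Fin n → ℝ≥0 → Ω → ℤ) (i : Fin n) (t : ℝ≥0) (ω : Ω) : ℤ :=
  Y i t ω + (i : ℤ)

/-- The event that `X(T) = X(0)` and `X_0(t) < X_1(t) < ⋯ < X_{n-1}(t)` for all `t ∈ [0, T]`. -/
def nonIntersectingEvent {Ω : Type*} {n : ℕ} (Y : Fin n → ℝ≥0 → Ω → ℤ) (T : ℝ≥0) : Set Ω :=
  {ω | (∀ i, walker Y i T ω = walker Y i 0 ω) ∧
    ∀ t ∈ Set.Icc 0 T, ∀ i j : Fin n, i < j → walker Y i t ω < walker Y j t ω}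

/-- The width `W_n(T) = sup_{t ∈ [0, T]} (X_{n-1}(t) - X_0(t))`; the supremum is taken in the
extended reals, so that it is always the true supremum. -/
def walkWidth {Ω : Type*} {n : ℕ} (hn : 0 < n) (Y : Fin n → ℝ≥0 → Ω → ℤ) (T : ℝ≥0) (ω : Ω) :
    EReal :=
  ⨆ t ∈ Set.Icc 0 T,
    (((walker Y ⟨n - 1, Nat.sub_lt hn Nat.one_pos⟩ t ω - walker Y ⟨0, hn⟩ t ω : ℤ) : ℝ) : EReal)

end

/-! The proof is the reflection principle for the affine Weyl group of type A, followed by Fourier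
inversion. Staying ordered with width below `M` means staying in the alcove `chamber n M`. With `M =
0` the alcove becomes the ordinary Weyl chamber and divisibility becomes equality, so one argument
computes both the numerator and the denominator of the conditional probability.

The function `alternatingSum n M` changes sign when two coordinates are exchanged modulo `M` with
the total sum fixed. The walkers' increments are exchangeable, so its expectation from any point of
`walls n M` vanishes (`integral_alternatingSum_of_mem_walls`). Paths that leave the alcove through a
wall therefore contribute nothing. On the alcove the function is the indicator of the starting point
(`alternatingSum_of_mem_chamber`), hence `measureReal_returnEvent`. The first exit is handled on
dyadic time grids: a step that skips the walls needs two jumps, which costs `O(m⁻²)` in each of `m`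
steps, and right-continuity recovers all times.

On the analytic side, the symbol is `e^T` times the characteristic function of a walker. Averaging
over the `M`-th roots of `s` selects residues modulo `M` and records winding numbers as powers of
`s`; integrating over `s` forces total winding zero. Expanding the determinants gives the same
alternating expectations, and the factors `e^{nT}` cancel. -/

/-! ### First exit from a region along a discrete-time path -/

section Exit

variable {Ω E : Type*} [MeasurableSpace Ω] {μ : Measure Ω} [IsProbabilityMeasure μ]

/-- Telescoping over the first exit time from `C`: an exit into `Z` contributes zero, point by
point, and an exit elsewhere costs at most `B * ε` per step. -/
theorem integral_sub_setIntegral_stay_le [Countable E] [MeasurableSpace E]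
    [MeasurableSingletonClass E] {S : ℕ → Ω → E} (hS : ∀ k, Measurable (S k))
    {F : Ω → ℝ} (hF : Measurable F) {B : ℝ} (hB : ∀ ω, |F ω| ≤ B) {C Z : Set E} {ε : ℝ} {m : ℕ}
    (h0 : ∀ ω, S 0 ω ∈ C)
    (hstep : ∀ k < m, μ.real {ω | S k ω ∈ C ∧ S (k + 1) ω ∉ C ∪ Z} ≤ ε)
    (hwall : ∀ k < m, ∀ z ∈ Z,
      ∫ ω in {ω | (∀ j ≤ k, S j ω ∈ C) ∧ S (k + 1) ω = z}, F ω ∂μ = 0) :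
    |∫ ω, F ω ∂μ - ∫ ω in {ω | ∀ j ≤ m, S j ω ∈ C}, F ω ∂μ| ≤ m * (B * ε) := by
  have hint : Integrable F μ := .of_bound hF.aestronglyMeasurable B (by simpa using .of_forall hB)
  have hmeas : ∀ (k : ℕ) (D : Set E), MeasurableSet {ω | S k ω ∈ D} := fun k D =>
    hS k D.to_countable.measurableSet
  have hA : ∀ k : ℕ, MeasurableSet {ω | ∀ j ≤ k, S j ω ∈ C} := fun k => by
    simp only [Set.ofPred_forall]
    exact .iInter fun j => .iInter fun _ => hmeas j C
  have hB0 : 0 ≤ B := by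
    obtain ⟨ω⟩ := μ.nonempty_of_neZero
    exact (abs_nonneg _).trans (hB ω)
  suffices h : ∀ k ≤ m,
      |∫ ω, F ω ∂μ - ∫ ω in {ω | ∀ j ≤ k, S j ω ∈ C}, F ω ∂μ| ≤ k * (B * ε) from h m le_rfl
  intro k
  induction k with
  | zero => intro _; simp [h0]
  | succ k ih =>
    intro hk
    have ih := ih (by omega)
    set A := {ω | ∀ j ≤ k, S j ω ∈ C} with hAdef
    set A' := {ω | ∀ j ≤ k + 1, S j ω ∈ C}
    -- `C` and `Z` are not assumed disjoint, so only `Z \ C` counts as an exit through the wall.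
    set D := {ω | (∀ j ≤ k, S j ω ∈ C) ∧ S (k + 1) ω ∈ Z \ C}
    set G := {ω | (∀ j ≤ k, S j ω ∈ C) ∧ S (k + 1) ω ∉ C ∪ Z}
    have hD : MeasurableSet D := (hA k).inter (hmeas (k + 1) (Z \ C))
    have hG : MeasurableSet G := (hA k).inter (hmeas (k + 1) (C ∪ Z)ᶜ)
    have hsplit : A = A' ∪ (D ∪ G) := by
      ext ω
      simp only [A, A', D, G, Set.mem_ofPred_eq, Set.mem_union, Set.mem_sdiff,
        Nat.le_add_one_iff, or_imp, forall_and, forall_eq]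
      tauto
    have hd1 : Disjoint A' (D ∪ G) := by
      rw [Set.disjoint_left]
      rintro ω h (⟨_, _, h2⟩ | ⟨_, h2⟩)
      · exact h2 (h _ le_rfl)
      · exact h2 (Or.inl (h _ le_rfl))
    have hd2 : Disjoint D G := by
      rw [Set.disjoint_left]
      rintro ω ⟨_, h1, _⟩ ⟨_, h2⟩
      exact h2 (Or.inr h1)
    have hDint : ∫ ω in D, F ω ∂μ = 0 := by
      have : D = ⋃ z : (Z \ C : Set E), {ω | (∀ j ≤ k, S j ω ∈ C) ∧ S (k + 1) ω = z} := by
        ext ω; simp [D]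
      rw [this, integral_iUnion]
      · have : ∀ z : (Z \ C : Set E),
            ∫ ω in {ω | (∀ j ≤ k, S j ω ∈ C) ∧ S (k + 1) ω = z}, F ω ∂μ = 0 :=
          fun z => hwall k (by omega) z z.2.1
        simp [this]
      · exact fun z => (hA k).inter (hmeas (k + 1) {z.1})
      · intro z w hzw
        refine Set.disjoint_left.2 fun ω h1 h2 => hzw (Subtype.ext (h1.2.symm.trans h2.2))
      · exact hint.integrableOn
    have hGint : |∫ ω in G, F ω ∂μ| ≤ B * ε := by
      have h1 : ‖∫ ω in G, F ω ∂μ‖ ≤ B * μ.real G :=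
        norm_setIntegral_le_of_norm_le_const (measure_lt_top μ G) fun ω _ => hB ω
      refine h1.trans (mul_le_mul_of_nonneg_left ?_ hB0)
      refine (measureReal_mono ?_).trans (hstep k (by omega))
      exact fun ω hω => ⟨hω.1 k le_rfl, hω.2⟩
    have hsum : ∫ ω in A, F ω ∂μ = ∫ ω in A', F ω ∂μ + ∫ ω in G, F ω ∂μ := by
      rw [hsplit, setIntegral_union hd1 (hD.union hG) hint.integrableOn hint.integrableOn,
        setIntegral_union hd2 hG hint.integrableOn hint.integrableOn, hDint, zero_add]
    rw [hsum] at ih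
    push_cast
    rw [abs_le] at *
    constructor <;> linarith [ih.1, ih.2, hGint.1, hGint.2]

end Exit

/-! ### Independence of past and future increments -/

section Increments

variable {Ω : Type*} [MeasurableSpace Ω] {μ : Measure Ω} {n : ℕ} {Y : Fin n → ℝ≥0 → Ω → ℤ}

theorem iIndepFun_increments (hY : ∀ i, IsSymmetricWalk μ (Y i))
    (hindep : iIndepFun (fun i ω t => Y i t ω) μ) {t : ℕ → ℝ≥0} (ht : Monotone t) :
    iIndepFun (fun (p : Fin n × ℕ) ω => Y p.1 (t (p.2 + 1)) ω - Y p.1 (t p.2) ω) μ := by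
  refine iIndepFun_uncurry' (X := fun i j ω => Y i (t (j + 1)) ω - Y i (t j) ω)
    (fun i j => ((hY i).measurable _).sub ((hY i).measurable _)) ?_
    fun i => (hY i).indep_increments.nat ht
  exact hindep.comp (fun _ y j => y (t (j + 1)) - y (t j))
    fun _ => measurable_pi_lambda _ fun j => (measurable_pi_apply _).sub (measurable_pi_apply _)

/-- Both sides are partial sums over disjoint blocks of the jointly independent array of one-step
increments. -/
theorem indepFun_past_future (hY : ∀ i, IsSymmetricWalk μ (Y i))
    (hindep : iIndepFun (fun i ω t => Y i t ω) μ) {t : ℕ → ℝ≥0} (ht : Monotone t) {k m : ℕ}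
    (hkm : k ≤ m) :
    IndepFun (fun ω (p : Fin n × Fin (k + 1)) => Y p.1 (t p.2) ω - Y p.1 (t 0) ω)
      (fun ω i => Y i (t m) ω - Y i (t k) ω) μ := by
  have h := (iIndepFun_increments hY hindep ht).indepFun_finset
    (Finset.univ ×ˢ Finset.range k) (Finset.univ ×ˢ Finset.Ico k m)
    (by
      refine Finset.disjoint_left.2 fun p h1 h2 => ?_
      simp only [Finset.mem_product, Finset.mem_range, Finset.mem_Ico] at h1 h2
      omega)
    fun p => ((hY p.1).measurable _).sub ((hY p.1).measurable _)
  let φ (u : (Finset.univ ×ˢ Finset.range k : Finset (Fin n × ℕ)) → ℤ)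
      (p : Fin n × Fin (k + 1)) : ℤ :=
    ∑ j : Fin p.2, u ⟨(p.1, j), by simp; omega⟩
  let ψ (u : (Finset.univ ×ˢ Finset.Ico k m : Finset (Fin n × ℕ)) → ℤ) (i : Fin n) : ℤ :=
    ∑ j : Finset.Ico k m, u ⟨(i, j), Finset.mem_product.2 ⟨Finset.mem_univ _, j.2⟩⟩
  have hφ : Measurable φ := by fun_prop
  have hψ : Measurable ψ := by fun_prop
  convert h.comp hφ hψ using 1
  · ext ω p
    simp only [φ, Function.comp_apply]
    rw [Fin.sum_univ_eq_sum_range (fun j => Y p.1 (t (j + 1)) ω - Y p.1 (t j) ω) p.2,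
      Finset.sum_range_sub (fun j => Y p.1 (t j) ω)]
  · ext ω i
    simp only [ψ, Function.comp_apply]
    rw [Finset.sum_coe_sort (Finset.Ico k m) (fun j => Y i (t (j + 1)) ω - Y i (t j) ω),
      Finset.sum_Ico_sub (fun j => Y i (t j) ω) hkm]

end Increments

/-! ### The generating function of the walk kernel -/

theorem invFactorial_natCast (a : ℕ) : invFactorial a = 1 / (a.factorial : ℝ) := by
  simp [invFactorial]

theorem invFactorial_of_neg {k : ℤ} (hk : k < 0) : invFactorial k = 0 := if_pos hk

theorem invFactorial_nonneg (k : ℤ) : 0 ≤ invFactorial k := by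
  unfold invFactorial
  split_ifs <;> positivity

theorem HasSum.mul_of_summable_norm {f g : ℕ → ℂ} {a b : ℂ} (hf : HasSum f a) (hg : HasSum g b)
    (hf' : Summable fun k => ‖f k‖) (hg' : Summable fun k => ‖g k‖) :
    HasSum (fun p : ℕ × ℕ => f p.1 * g p.2) (a * b) :=
  hf.mul hg (summable_mul_of_summable_norm hf' hg')

theorem hasSum_pow_div_factorial (w : ℂ) :
    HasSum (fun k : ℕ => w ^ k / (k.factorial : ℂ)) (Complex.exp w) := by
  rw [Complex.exp_eq_exp_ℂ]
  exact NormedSpace.expSeries_div_hasSum_exp w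

theorem summable_norm_pow_div_factorial (w : ℂ) :
    Summable fun k : ℕ => ‖w ^ k / (k.factorial : ℂ)‖ := by
  simpa using Real.summable_pow_div_factorial ‖w‖

theorem hasSum_exp_mul_exp (c d : ℂ) :
    HasSum (fun p : ℕ × ℕ => c ^ p.1 / (p.1.factorial : ℂ) * (d ^ p.2 / (p.2.factorial : ℂ)))
      (Complex.exp c * Complex.exp d) := by
  simpa only using HasSum.mul_of_summable_norm (f := fun k : ℕ => c ^ k / (k.factorial : ℂ))
    (g := fun k : ℕ => d ^ k / (k.factorial : ℂ))
    (hasSum_pow_div_factorial c) (hasSum_pow_div_factorial d)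
    (summable_norm_pow_div_factorial c) (summable_norm_pow_div_factorial d)

theorem walkKernel_term_sub (t : ℝ) {z : ℂ} (hz : z ≠ 0) (a b : ℕ) :
    (((t / 2) ^ (2 * (b : ℤ) + ((a : ℤ) - b)) *
      (invFactorial b * invFactorial (b + ((a : ℤ) - b))) : ℝ) : ℂ) * z ^ ((a : ℤ) - b) =
      ((t : ℂ) / 2 * z) ^ a / a.factorial * (((t : ℂ) / 2 * z⁻¹) ^ b / b.factorial) := by
  have e1 : 2 * (b : ℤ) + ((a : ℤ) - b) = ((a + b : ℕ) : ℤ) := by push_cast; ring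
  have e2 : (b : ℤ) + ((a : ℤ) - b) = (a : ℤ) := by ring
  rw [e1, e2, invFactorial_natCast, invFactorial_natCast, zpow_natCast, zpow_sub₀ hz,
    zpow_natCast, zpow_natCast, mul_pow, mul_pow, inv_pow, pow_add]
  push_cast
  ring

/-- This is the product of the series of `exp (T z / 2)` and `exp (T z⁻¹ / 2)`, reindexed by `(a, b)
↦ (a - b, b)`. Pairs outside the image carry the reciprocal factorial of a negative integer and
vanish. -/
theorem hasSum_walkSymbol_prod (T : ℝ≥0) {z : ℂ} (hz : z ≠ 0) :
    HasSum (fun p : ℤ × ℤ => ((((T : ℝ) / 2) ^ (2 * p.2 + p.1) *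
      (invFactorial p.2 * invFactorial (p.2 + p.1)) : ℝ) : ℂ) * z ^ p.1) (walkSymbol T z) := by
  have h := hasSum_exp_mul_exp (((T : ℝ) : ℂ) / 2 * z) (((T : ℝ) : ℂ) / 2 * z⁻¹)
  rw [← Complex.exp_add, ← mul_add] at h
  let e : ℕ × ℕ → ℤ × ℤ := fun p => ((p.1 : ℤ) - p.2, p.2)
  have he : Function.Injective e := by
    rintro ⟨a, b⟩ ⟨a', b'⟩ hab
    simp only [e, Prod.mk.injEq] at hab ⊢
    omega
  refine (he.hasSum_iff ?_).1 (h.congr_fun fun p => walkKernel_term_sub T hz p.1 p.2)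
  rintro ⟨k, m⟩ hkm
  have : m < 0 ∨ m + k < 0 := by
    by_contra! hcon
    refine hkm ⟨((m + k).toNat, m.toNat), ?_⟩
    simp only [e, Prod.mk.injEq]
    omega
  rcases this with h | h <;> simp [invFactorial_of_neg h]

theorem summable_walkKernel_terms (t : ℝ≥0) (k : ℤ) :
    Summable fun m : ℤ =>
      ((t : ℝ) / 2) ^ (2 * m + k) * (invFactorial m * invFactorial (m + k)) := by
  have h := (hasSum_walkSymbol_prod t one_ne_zero).summable.prod_factor k
  simpa only [one_zpow, mul_one, Complex.summable_ofReal] using h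

theorem hasSum_walkKernel (T : ℝ≥0) {z : ℂ} (hz : z ≠ 0) :
    HasSum (fun k : ℤ => (walkKernel T k : ℂ) * z ^ k)
      (Complex.exp (-((T : ℝ) : ℂ)) * walkSymbol T z) := by
  have h := (hasSum_walkSymbol_prod T hz).prod_fiberwise fun k =>
    (Complex.hasSum_ofReal.2 (summable_walkKernel_terms T k).hasSum).mul_right (z ^ k)
  simpa [walkKernel, mul_assoc] using h.mul_left (Complex.exp (-((T : ℝ) : ℂ)))

section Increments

variable {Ω : Type*} [MeasurableSpace Ω] {μ : Measure Ω} {n : ℕ} {Y : Fin n → ℝ≥0 → Ω → ℤ}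

/-! ### Exchangeability of the increments -/

theorem map_increment_eq [IsProbabilityMeasure μ] (hY : ∀ i, IsSymmetricWalk μ (Y i))
    {s t : ℝ≥0} (hst : s ≤ t) (i j : Fin n) :
    μ.map (fun ω => Y i t ω - Y i s ω) = μ.map (fun ω => Y j t ω - Y j s ω) := by
  have hm : ∀ i, Measurable fun ω => Y i t ω - Y i s ω := fun i =>
    ((hY i).measurable t).sub ((hY i).measurable s)
  refine Measure.ext_of_singleton fun k => ?_
  rw [Measure.map_apply (hm i) (by simp), Measure.map_apply (hm j) (by simp)]
  exact ((hY i).law_increment s t hst k).trans ((hY j).law_increment s t hst k).symm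

theorem iIndepFun_increment (hindep : iIndepFun (fun i ω t => Y i t ω) μ) (s t : ℝ≥0) :
    iIndepFun (fun i ω => Y i t ω - Y i s ω) μ :=
  hindep.comp (fun _ y => y t - y s) fun _ => by fun_prop

/-- The joint law is a product of identical marginals. -/
theorem map_increment_perm [IsProbabilityMeasure μ] (hY : ∀ i, IsSymmetricWalk μ (Y i))
    (hindep : iIndepFun (fun i ω t => Y i t ω) μ) {s t : ℝ≥0} (hst : s ≤ t)
    (σ : Equiv.Perm (Fin n)) :
    μ.map (fun ω i => Y (σ i) t ω - Y (σ i) s ω) = μ.map (fun ω i => Y i t ω - Y i s ω) := by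
  have hm : ∀ i, AEMeasurable (fun ω => Y i t ω - Y i s ω) μ := fun i =>
    (((hY i).measurable t).sub ((hY i).measurable s)).aemeasurable
  have h := iIndepFun_increment hindep s t
  rw [h.map_fun_eq_pi_map hm, (h.precomp σ.injective).map_fun_eq_pi_map fun i => hm (σ i)]
  congr 1
  funext i
  exact map_increment_eq hY hst (σ i) i

/-! ### Probability of two jumps in a short time -/

theorem le_walkKernel (t : ℝ≥0) (k m : ℤ) :
    Real.exp (-(t : ℝ)) * (((t : ℝ) / 2) ^ (2 * m + k) * (invFactorial m * invFactorial (m + k))) ≤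
      walkKernel t k := by
  refine mul_le_mul_of_nonneg_left ?_ (Real.exp_pos _).le
  exact (summable_walkKernel_terms t k).le_tsum m fun j _ => mul_nonneg (by positivity)
    (mul_nonneg (invFactorial_nonneg _) (invFactorial_nonneg _))

theorem exp_neg_le_walkKernel_zero (t : ℝ≥0) : Real.exp (-(t : ℝ)) ≤ walkKernel t 0 := by
  simpa [invFactorial] using le_walkKernel t 0 0

theorem le_walkKernel_one (t : ℝ≥0) : Real.exp (-(t : ℝ)) * (t / 2) ≤ walkKernel t 1 := by
  simpa [invFactorial] using le_walkKernel t 1 0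

theorem le_walkKernel_neg_one (t : ℝ≥0) : Real.exp (-(t : ℝ)) * (t / 2) ≤ walkKernel t (-1) := by
  simpa [invFactorial] using le_walkKernel t (-1) 1

theorem walkKernel_nonneg (t : ℝ≥0) (k : ℤ) : 0 ≤ walkKernel t k :=
  mul_nonneg (Real.exp_pos _).le <| tsum_nonneg fun j => mul_nonneg (by positivity)
    (mul_nonneg (invFactorial_nonneg _) (invFactorial_nonneg _))

theorem IsSymmetricWalk.measureReal_increment_eq {X : ℝ≥0 → Ω → ℤ} (hX : IsSymmetricWalk μ X)
    {s t : ℝ≥0} (hst : s ≤ t) (k : ℤ) :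
    μ.real {ω | X t ω - X s ω = k} = walkKernel (t - s) k := by
  rw [measureReal_def, hX.law_increment s t hst k, ENNReal.toReal_ofReal (walkKernel_nonneg _ _)]

variable [IsProbabilityMeasure μ]

theorem IsSymmetricWalk.measureReal_increment_ne_zero_le {X : ℝ≥0 → Ω → ℤ}
    (hX : IsSymmetricWalk μ X) {s t : ℝ≥0} (hst : s ≤ t) :
    μ.real {ω | X t ω - X s ω ≠ 0} ≤ (t - s : ℝ≥0) := by
  have hm : MeasurableSet {ω | X t ω - X s ω = 0} :=
    ((hX.measurable t).sub (hX.measurable s)) (measurableSet_singleton 0)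
  have h : μ.real {ω | X t ω - X s ω = 0}ᶜ = 1 - walkKernel (t - s) 0 := by
    rw [probReal_compl_eq_one_sub hm, hX.measureReal_increment_eq hst]
  have h1 := exp_neg_le_walkKernel_zero (t - s)
  have h2 := Real.add_one_le_exp (-((t - s : ℝ≥0) : ℝ))
  have h3 : {ω | X t ω - X s ω ≠ 0} = {ω | X t ω - X s ω = 0}ᶜ := rfl
  rw [h3, h]
  linarith

/-- With `h = t - s`, the values `0, ±1` carry mass at least `e^{-h} (1 + h) ≥ (1 - h) (1 + h)`. -/
theorem IsSymmetricWalk.measureReal_two_jumps_le {X : ℝ≥0 → Ω → ℤ}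
    (hX : IsSymmetricWalk μ X) {s t : ℝ≥0} (hst : s ≤ t) :
    μ.real {ω | 1 < |X t ω - X s ω|} ≤ ((t - s : ℝ≥0) : ℝ) ^ 2 := by
  have hm : ∀ k, MeasurableSet {ω | X t ω - X s ω = k} := fun k =>
    ((hX.measurable t).sub (hX.measurable s)) (measurableSet_singleton k)
  have hset : {ω | 1 < |X t ω - X s ω|} = ({ω | X t ω - X s ω = 0} ∪
      ({ω | X t ω - X s ω = 1} ∪ {ω | X t ω - X s ω = -1}))ᶜ := by
    ext ω
    simp only [Set.mem_ofPred_eq, Set.mem_compl_iff, Set.mem_union, lt_abs]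
    omega
  rw [hset, probReal_compl_eq_one_sub ((hm 0).union ((hm 1).union (hm (-1)))),
    measureReal_union _ ((hm 1).union (hm (-1))), measureReal_union _ (hm (-1)),
    hX.measureReal_increment_eq hst, hX.measureReal_increment_eq hst,
    hX.measureReal_increment_eq hst]
  · have h0 := exp_neg_le_walkKernel_zero (t - s)
    have h1 := le_walkKernel_one (t - s)
    have h2 := le_walkKernel_neg_one (t - s)
    have h3 := Real.add_one_le_exp (-((t - s : ℝ≥0) : ℝ))
    have h4 : (0 : ℝ) ≤ (t - s : ℝ≥0) := NNReal.coe_nonneg _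
    nlinarith
  · refine Set.disjoint_left.2 fun ω h1 h2 => ?_
    simp only [Set.mem_ofPred_eq] at h1 h2
    omega
  · refine Set.disjoint_left.2 fun ω h1 h2 => ?_
    simp only [Set.mem_ofPred_eq, Set.mem_union] at h1 h2
    omega

/-- Union bound: `n` events of a large increment, and `n * n` ordered pairs of walkers that both
move. -/
theorem measureReal_not_single_step_le (hY : ∀ i, IsSymmetricWalk μ (Y i))
    (hindep : iIndepFun (fun i ω t => Y i t ω) μ) {s t : ℝ≥0} (hst : s ≤ t) :
    μ.real {ω | ¬ ((∀ i, |Y i t ω - Y i s ω| ≤ 1) ∧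
      ∀ i j, i ≠ j → Y i t ω - Y i s ω = 0 ∨ Y j t ω - Y j s ω = 0)} ≤
      (n + n * n : ℝ) * ((t - s : ℝ≥0) : ℝ) ^ 2 := by
  set P : Fin n × Fin n → Set Ω := fun p =>
    if p.1 = p.2 then ∅ else {ω | Y p.1 t ω - Y p.1 s ω ≠ 0 ∧ Y p.2 t ω - Y p.2 s ω ≠ 0}
  have hP : ∀ p, μ.real (P p) ≤ ((t - s : ℝ≥0) : ℝ) ^ 2 := by
    intro p
    by_cases hp : p.1 = p.2
    · simp [P, hp]
    · simp only [P, if_neg hp]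
      have h := ((iIndepFun_increment hindep s t).indepFun hp).measure_inter_preimage_eq_mul
        {0}ᶜ {0}ᶜ (by simp) (by simp)
      have h' : μ.real {ω | Y p.1 t ω - Y p.1 s ω ≠ 0 ∧ Y p.2 t ω - Y p.2 s ω ≠ 0} =
          μ.real {ω | Y p.1 t ω - Y p.1 s ω ≠ 0} * μ.real {ω | Y p.2 t ω - Y p.2 s ω ≠ 0} := by
        simp only [measureReal_def, ← ENNReal.toReal_mul]
        exact congrArg _ h
      rw [h', sq]
      exact mul_le_mul ((hY _).measureReal_increment_ne_zero_le hst)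
        ((hY _).measureReal_increment_ne_zero_le hst) measureReal_nonneg (NNReal.coe_nonneg _)
  calc _ ≤ μ.real ((⋃ i, {ω | 1 < |Y i t ω - Y i s ω|}) ∪ ⋃ p, P p) := by
        refine measureReal_mono fun ω hω => ?_
        simp only [Set.mem_ofPred_eq, not_and_or, not_forall, not_le, not_or] at hω
        obtain ⟨i, hi⟩ | ⟨i, j, hij, h⟩ := hω
        · exact Or.inl (Set.mem_iUnion.2 ⟨i, hi⟩)
        · refine Or.inr (Set.mem_iUnion.2 ⟨(i, j), ?_⟩)
          simpa [P, hij] using h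
    _ ≤ ∑ i, μ.real {ω | 1 < |Y i t ω - Y i s ω|} + ∑ p, μ.real (P p) :=
        (measureReal_union_le _ _).trans
          (add_le_add (measureReal_iUnion_fintype_le _) (measureReal_iUnion_fintype_le _))
    _ ≤ ∑ _ : Fin n, ((t - s : ℝ≥0) : ℝ) ^ 2 + ∑ _ : Fin n × Fin n, ((t - s : ℝ≥0) : ℝ) ^ 2 :=
        add_le_add (Finset.sum_le_sum fun i _ => (hY i).measureReal_two_jumps_le hst)
          (Finset.sum_le_sum fun p _ => hP p)
    _ = _ := by
        simp only [Finset.sum_const, Finset.card_univ, Fintype.card_fin, Fintype.card_prod,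
          nsmul_eq_mul]
        push_cast
        ring

end Increments

/-! ### Dyadic time grids and right-continuous paths -/

section Paths

variable {Ω : Type*} {n : ℕ}

/-- The configuration of the walkers, started exactly at `(0, 1, …, n - 1)`. -/
def configuration (Y : Fin n → ℝ≥0 → Ω → ℤ) (t : ℝ≥0) (ω : Ω) (i : Fin n) : ℤ :=
  (i : ℤ) + (Y i t ω - Y i 0 ω)

/-- The point `j T / m` of the regular grid on `[0, T]`. -/
noncomputable def gridTime (T : ℝ≥0) (m j : ℕ) : ℝ≥0 := j * T / m

theorem gridTime_mono (T : ℝ≥0) (m : ℕ) : Monotone (gridTime T m) := fun a b hab => by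
  unfold gridTime
  gcongr

@[simp] theorem gridTime_zero (T : ℝ≥0) (m : ℕ) : gridTime T m 0 = 0 := by simp [gridTime]

theorem gridTime_self (T : ℝ≥0) {m : ℕ} (hm : m ≠ 0) : gridTime T m m = T := by
  have : (m : ℝ≥0) ≠ 0 := by exact_mod_cast hm
  unfold gridTime
  field_simp

theorem gridTime_succ_sub (T : ℝ≥0) (m j : ℕ) :
    ((gridTime T m (j + 1) - gridTime T m j : ℝ≥0) : ℝ) = T / m := by
  rw [NNReal.coe_sub (gridTime_mono T m j.le_succ)]
  simp only [gridTime]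
  push_cast
  ring

theorem gridTime_le (T : ℝ≥0) {m j : ℕ} (hm : m ≠ 0) (hj : j ≤ m) : gridTime T m j ≤ T :=
  (gridTime_mono T m hj).trans_eq (gridTime_self T hm)

theorem gridTime_two_mul (T : ℝ≥0) (m j : ℕ) : gridTime T (2 * m) (2 * j) = gridTime T m j := by
  unfold gridTime
  push_cast
  rw [mul_assoc, mul_div_mul_left _ _ two_ne_zero]

theorem exists_gridTime_mem_Ico {T t u : ℝ≥0} (htT : t < T) (htu : t < u) :
    ∃ N j : ℕ, j ≤ 2 ^ N ∧ gridTime T (2 ^ N) j ∈ Set.Ico t u := by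
  have hT : 0 < (T : ℝ) := lt_of_le_of_lt t.2 htT
  have hd : 0 < ((u : ℝ) - t) / T := div_pos (sub_pos.2 htu) hT
  obtain ⟨N, hN⟩ := exists_pow_lt_of_lt_one hd (by norm_num : (1 / 2 : ℝ) < 1)
  have h2 : (0 : ℝ) < 2 ^ N := by positivity
  have hN' : (T : ℝ) / 2 ^ N < u - t := by
    rw [lt_div_iff₀ hT] at hN
    simpa [div_eq_mul_inv, mul_comm] using hN
  -- The index of the first grid point at or after `t`; the mesh is smaller than `u - t`.
  refine ⟨N, ⌈(t : ℝ) * 2 ^ N / T⌉₊, ?_, ?_, ?_⟩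
  · rw [Nat.ceil_le, div_le_iff₀ hT]
    push_cast
    have : (t : ℝ) ≤ T := htT.le
    nlinarith
  · rw [← NNReal.coe_le_coe]
    simp only [gridTime]
    push_cast
    rw [le_div_iff₀ h2, ← div_le_iff₀ hT]
    exact Nat.le_ceil _
  · rw [← NNReal.coe_lt_coe]
    simp only [gridTime]
    push_cast
    have h := Nat.ceil_lt_add_one (a := (t : ℝ) * 2 ^ N / T) (by positivity)
    calc (⌈(t : ℝ) * 2 ^ N / T⌉₊ : ℝ) * T / 2 ^ N < ((t : ℝ) * 2 ^ N / T + 1) * T / 2 ^ N := by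
          gcongr
      _ = t + T / 2 ^ N := by field_simp
      _ < u := by linarith

/-- A right-continuous integer path is constant on a short interval to the right of `t`, which
contains a dyadic point when `t < T`. The time `T` is itself a grid point. -/
theorem forall_gridTime_mem_iff {Y : Fin n → ℝ≥0 → Ω → ℤ} {ω : Ω}
    (hω : ∀ i t, ContinuousWithinAt (fun u => Y i u ω) (Set.Ici t) t) (T : ℝ≥0)
    (C : Set (Fin n → ℤ)) :
    (∀ N j : ℕ, j ≤ 2 ^ N → configuration Y (gridTime T (2 ^ N) j) ω ∈ C) ↔
      ∀ t ≤ T, configuration Y t ω ∈ C := by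
  refine ⟨fun h t ht => ?_, fun h N j hj => h _ (gridTime_le T (by positivity) hj)⟩
  rcases ht.eq_or_lt with rfl | ht
  · simpa [gridTime_self] using h 0 1 (by simp)
  have hev : ∀ᶠ u in 𝓝[≥] t, ∀ i, Y i u ω = Y i t ω :=
    eventually_all.2 fun i => (hω i t).eventually (p := fun v => v = Y i t ω) (by simp [nhds_discrete])
  obtain ⟨u, hu, hsub⟩ := (mem_nhdsGE_iff_exists_Ico_subset' (u' := T) ht).1 hev
  obtain ⟨N, j, hj, hmem⟩ := exists_gridTime_mem_Ico ht (Set.mem_Ioi.1 hu)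
  convert h N j hj using 1
  ext i
  simp only [configuration]
  rw [hsub hmem i]

end Paths

/-! ### Vanishing on the walls implies a stay-in-the-region identity -/

section Reflection

variable {Ω : Type*} [MeasurableSpace Ω] {μ : Measure Ω} {n : ℕ} {Y : Fin n → ℝ≥0 → Ω → ℤ}

theorem measurable_configuration (hY : ∀ i, IsSymmetricWalk μ (Y i)) (t : ℝ≥0) :
    Measurable (configuration Y t) :=
  measurable_pi_lambda _ fun i =>
    measurable_const.add (((hY i).measurable t).sub ((hY i).measurable 0))

/-- Markov property at time `t (k + 1)`: the event depends on the past alone, and on it the final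
configuration is `z` plus an independent future increment, so the integral factors. -/
theorem setIntegral_configuration_eq_zero (hY : ∀ i, IsSymmetricWalk μ (Y i))
    (hindep : iIndepFun (fun i ω t => Y i t ω) μ) {t : ℕ → ℝ≥0} (ht : Monotone t) (ht0 : t 0 = 0)
    {k m : ℕ} (hkm : k < m) (C : Set (Fin n → ℤ)) (f : (Fin n → ℤ) → ℝ) (z : Fin n → ℤ)
    (hz : ∫ ω, f (fun i => z i + (Y i (t m) ω - Y i (t (k + 1)) ω)) ∂μ = 0) :
    ∫ ω in {ω | (∀ j ≤ k, configuration Y (t j) ω ∈ C) ∧ configuration Y (t (k + 1)) ω = z},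
      f (configuration Y (t m) ω) ∂μ = 0 := by
  set A := {ω | (∀ j ≤ k, configuration Y (t j) ω ∈ C) ∧ configuration Y (t (k + 1)) ω = z}
  have hA : MeasurableSet A := by
    refine .inter (s₁ := {ω | ∀ j ≤ k, configuration Y (t j) ω ∈ C}) ?_
      (measurable_configuration hY _ (measurableSet_singleton z))
    simp only [Set.ofPred_forall]
    exact .iInter fun j => .iInter fun _ => measurable_configuration hY _ C.to_countable.measurableSet
  let past (ω : Ω) (p : Fin n × Fin (k + 1 + 1)) : ℤ := Y p.1 (t p.2) ω - Y p.1 (t 0) ω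
  let fut (ω : Ω) (i : Fin n) : ℤ := Y i (t m) ω - Y i (t (k + 1)) ω
  let A₀ : Set (Fin n × Fin (k + 1 + 1) → ℤ) := {u |
    (∀ (j : ℕ) (hj : j ≤ k), (fun i : Fin n => (i : ℤ) + u (i, ⟨j, by omega⟩)) ∈ C) ∧
      (fun i : Fin n => (i : ℤ) + u (i, ⟨k + 1, by omega⟩)) = z}
  have hind : IndepFun past fut μ := indepFun_past_future hY hindep ht (by omega : k + 1 ≤ m)
  have hpast : Measurable past := measurable_pi_lambda _ fun p =>
    ((hY p.1).measurable _).sub ((hY p.1).measurable _)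
  have hfut : Measurable fut := measurable_pi_lambda _ fun i =>
    ((hY i).measurable _).sub ((hY i).measurable _)
  have key := hind.integral_fun_comp_mul_comp (f := A₀.indicator fun _ => (1 : ℝ))
    (g := fun v => f (fun i => z i + v i)) hpast.aemeasurable hfut.aemeasurable
    (measurable_one.indicator A₀.to_countable.measurableSet).aestronglyMeasurable
    (Measurable.of_discrete).aestronglyMeasurable
  rw [hz, mul_zero] at key
  rw [← integral_indicator hA, ← key]
  congr 1
  ext ω
  have hmem : past ω ∈ A₀ ↔ ω ∈ A := by
    simp only [A₀, A, past, Set.mem_ofPred_eq, configuration, ht0, funext_iff]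
    rfl
  by_cases hω : ω ∈ A
  · rw [Set.indicator_of_mem hω, Set.indicator_of_mem (hmem.2 hω), one_mul]
    congr 1
    ext i
    rw [← congrFun hω.2 i]
    simp only [configuration, fut]
    ring
  · rw [Set.indicator_of_notMem hω, Set.indicator_of_notMem (hmem.not.2 hω), zero_mul]

variable [IsProbabilityMeasure μ] {C Z : Set (Fin n → ℤ)} {f : (Fin n → ℤ) → ℝ} {B : ℝ}

theorem integral_sub_setIntegral_grid_le (hY : ∀ i, IsSymmetricWalk μ (Y i))
    (hindep : iIndepFun (fun i ω t => Y i t ω) μ) (hB : ∀ x, |f x| ≤ B)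
    (h0 : (fun i : Fin n => (i : ℤ)) ∈ C)
    (hC : ∀ x ∈ C, ∀ y : Fin n → ℤ, (∀ i, |y i - x i| ≤ 1) →
      (∀ i j, i ≠ j → y i - x i = 0 ∨ y j - x j = 0) → y ∈ C ∪ Z)
    (hZ : ∀ s t, s ≤ t → ∀ z ∈ Z, ∫ ω, f (fun i => z i + (Y i t ω - Y i s ω)) ∂μ = 0)
    (T : ℝ≥0) {m : ℕ} (hm : m ≠ 0) :
    |∫ ω, f (configuration Y T ω) ∂μ -
      ∫ ω in {ω | ∀ j ≤ m, configuration Y (gridTime T m j) ω ∈ C},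
        f (configuration Y T ω) ∂μ| ≤ m * (B * ((n + n * n) * ((T : ℝ) / m) ^ 2)) := by
  have hmono := gridTime_mono T m
  refine integral_sub_setIntegral_stay_le (Z := Z)
    (S := fun k => configuration Y (gridTime T m k))
    (fun k => measurable_configuration hY _)
    ((Measurable.of_discrete (f := f)).comp (measurable_configuration hY T))
    (fun ω => hB _) (fun ω => ?_) (fun k _ => ?_) (fun k hk z hz => ?_)
  · convert h0 using 1
    ext i
    simp [configuration]
  · have h := measureReal_not_single_step_le hY hindep (hmono k.le_succ)
    rw [gridTime_succ_sub] at h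
    refine (measureReal_mono ?_).trans h
    rintro ω ⟨h1, h2⟩ ⟨h3, h4⟩
    refine h2 (hC _ h1 _ (fun i => ?_) fun i j hij => ?_)
    · convert h3 i using 2
      simp only [configuration]
      ring
    · convert h4 i j hij using 2 <;> (simp only [configuration]; ring)
  · have h := setIntegral_configuration_eq_zero hY hindep hmono (gridTime_zero T m) hk C f z
      (hZ _ _ (hmono (by omega)) z hz)
    rwa [gridTime_self T hm] at h

/-- The grid error is of order `1 / m`. Along `m = 2 ^ N` the grids are nested, so the grid events
decrease to their intersection and the error tends to zero. -/
theorem setIntegral_stay_eq_integral (hY : ∀ i, IsSymmetricWalk μ (Y i))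
    (hindep : iIndepFun (fun i ω t => Y i t ω) μ) (hB : ∀ x, |f x| ≤ B)
    (h0 : (fun i : Fin n => (i : ℤ)) ∈ C)
    (hC : ∀ x ∈ C, ∀ y : Fin n → ℤ, (∀ i, |y i - x i| ≤ 1) →
      (∀ i j, i ≠ j → y i - x i = 0 ∨ y j - x j = 0) → y ∈ C ∪ Z)
    (hZ : ∀ s t, s ≤ t → ∀ z ∈ Z, ∫ ω, f (fun i => z i + (Y i t ω - Y i s ω)) ∂μ = 0)
    (T : ℝ≥0) :
    ∫ ω in {ω | ∀ N j : ℕ, j ≤ 2 ^ N → configuration Y (gridTime T (2 ^ N) j) ω ∈ C},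
      f (configuration Y T ω) ∂μ = ∫ ω, f (configuration Y T ω) ∂μ := by
  set A : ℕ → Set Ω := fun N => {ω | ∀ j ≤ 2 ^ N, configuration Y (gridTime T (2 ^ N) j) ω ∈ C}
  have hA : ∀ N, MeasurableSet (A N) := fun N => by
    simp only [A, Set.ofPred_forall]
    exact .iInter fun j => .iInter fun _ => measurable_configuration hY _ C.to_countable.measurableSet
  have hanti : Antitone A := antitone_nat_of_succ_le fun N ω hω j hj => by
    have := hω (2 * j) (by rw [pow_succ]; omega)
    rwa [pow_succ', gridTime_two_mul] at this
  have hF : Measurable fun ω => f (configuration Y T ω) :=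
    (Measurable.of_discrete (f := f)).comp (measurable_configuration hY T)
  have hint : Integrable (fun ω => f (configuration Y T ω)) μ :=
    .of_bound hF.aestronglyMeasurable B (by simpa using .of_forall fun ω => hB _)
  have hlim := tendsto_setIntegral_of_antitone hA hanti ⟨0, hint.integrableOn⟩
  have hset : ⋂ N, A N =
      {ω | ∀ N j : ℕ, j ≤ 2 ^ N → configuration Y (gridTime T (2 ^ N) j) ω ∈ C} := by
    ext ω; simp [A]
  rw [hset] at hlim
  refine tendsto_nhds_unique hlim (tendsto_iff_norm_sub_tendsto_zero.2 ?_)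
  set K : ℝ := B * (n + n * n) * T ^ 2
  have hK : Tendsto (fun N : ℕ => K * (1 / 2 : ℝ) ^ N) atTop (𝓝 0) := by
    simpa using (tendsto_pow_atTop_nhds_zero_of_lt_one (by norm_num : (0 : ℝ) ≤ 1 / 2)
      (by norm_num)).const_mul K
  refine squeeze_zero (fun _ => norm_nonneg _) (fun N => ?_) hK
  have h := integral_sub_setIntegral_grid_le hY hindep hB h0 hC hZ T (m := 2 ^ N) (by positivity)
  rw [Real.norm_eq_abs, abs_sub_comm]
  refine h.trans_eq ?_
  simp only [K]
  rw [one_div, inv_pow]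
  push_cast
  field_simp

end Reflection

/-! ### The alcove as a fundamental domain -/

section Chamber

variable {n M : ℕ}

/-- The alcove `x₀ < x₁ < ⋯ < xₙ₋₁ < x₀ + M`; for `M = 0` the last inequality is dropped. -/
def chamber (n M : ℕ) : Set (Fin n → ℤ) :=
  {x | ∀ i j, i < j → x i < x j ∧ (M ≠ 0 → x j < x i + M)}

/-- Configurations with two walkers in the same class modulo `M`. -/
def walls (n M : ℕ) : Set (Fin n → ℤ) :=
  {x | ∃ i j, i ≠ j ∧ (M : ℤ) ∣ x i - x j}

open Classical in
/-- The alternating sum over the affine Weyl group orbit of `(0, 1, …, n - 1)`. -/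
noncomputable def alternatingSum (n M : ℕ) (x : Fin n → ℤ) : ℝ :=
  ∑ σ : Equiv.Perm (Fin n), ((Equiv.Perm.sign σ : ℤ) : ℝ) *
    if (∀ k, (M : ℤ) ∣ x k - (σ k : ℤ)) ∧ ∑ k, x k = ∑ k : Fin n, (k : ℤ) then 1 else 0

theorem abs_alternatingSum_le (x : Fin n → ℤ) : |alternatingSum n M x| ≤ n.factorial := by
  refine (Finset.abs_sum_le_sum_abs _ _).trans ?_
  calc _ ≤ ∑ _ : Equiv.Perm (Fin n), (1 : ℝ) := by
        refine Finset.sum_le_sum fun σ _ => ?_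
        rw [abs_mul]
        have h1 : |((Equiv.Perm.sign σ : ℤ) : ℝ)| = 1 := by
          rcases Int.units_eq_one_or (Equiv.Perm.sign σ) with h | h <;> simp [h]
        rw [h1, one_mul]
        split_ifs <;> simp
    _ = _ := by simp [Fintype.card_perm]

/-- Reindex the sum by `σ ↦ σ * swap i j`, which flips every sign. -/
theorem alternatingSum_swap {x y : Fin n → ℤ} {i j : Fin n} (hij : i ≠ j)
    (hxy : ∀ k, (M : ℤ) ∣ y k - x (Equiv.swap i j k)) (hsum : ∑ k, y k = ∑ k, x k) :
    alternatingSum n M y = -alternatingSum n M x := by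
  unfold alternatingSum
  rw [← Equiv.sum_comp (Equiv.mulRight (Equiv.swap i j)), ← Finset.sum_neg_distrib]
  refine Finset.sum_congr rfl fun σ _ => ?_
  have hiff : (∀ k, (M : ℤ) ∣ y k - ((σ * Equiv.swap i j) k : ℤ)) ↔
      ∀ k, (M : ℤ) ∣ x k - (σ k : ℤ) := by
    rw [← (Equiv.swap i j).forall_congr_right (q := fun k => (M : ℤ) ∣ x k - (σ k : ℤ))]
    refine forall_congr' fun k => ?_
    rw [Equiv.Perm.mul_apply, ← dvd_iff_dvd_of_dvd_sub (a := (M : ℤ)) (c := x _ - _) (b := y k - _)]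
    simpa using hxy k
  simp only [Equiv.coe_mulRight, hiff, hsum, Equiv.Perm.sign_mul, Equiv.Perm.sign_swap hij]
  push_cast
  ring

/-- When at most one walker moves, by at most one unit, each difference of coordinates changes by at
most one; an alcove inequality can fail only after equality modulo `M`. -/
theorem mem_chamber_union_walls_of_step {x y : Fin n → ℤ} (hx : x ∈ chamber n M)
    (h1 : ∀ i, |y i - x i| ≤ 1) (h2 : ∀ i j, i ≠ j → y i - x i = 0 ∨ y j - x j = 0) :
    y ∈ chamber n M ∪ walls n M := by
  by_contra hcon
  rw [Set.mem_union, not_or] at hcon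
  obtain ⟨hc, hw⟩ := hcon
  simp only [walls, Set.mem_ofPred_eq, not_exists, not_and] at hw
  refine hc fun i j hij => ?_
  have hx' := hx i j hij
  have a := abs_le.1 (h1 i)
  have b := abs_le.1 (h1 j)
  have c := h2 i j hij.ne
  have hw1 : y i ≠ y j := fun h => hw i j hij.ne (by simp [h])
  have hw2 : y j ≠ y i + M := fun h => hw j i hij.ne' (by simp [h])
  refine ⟨by omega, fun hM => ?_⟩
  have := hx'.2 hM
  omega

theorem perm_eq_one_of_strictMono {σ : Equiv.Perm (Fin n)} (h : StrictMono σ) : σ = 1 := by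
  exact Equiv.coe_fn_injective
    ((Set.range_injOn_strictMono h strictMono_id (by simp)).trans rfl)

/-- Write `x k = σ k + M * v k`. A point of the alcove forces `n ≤ M`, so the `σ k` lie in `[0, M)`.
The alcove inequalities then make `v` weakly increasing with spread at most one, and the sum
condition gives `∑ v = 0`; hence `v = 0`. -/
theorem eq_of_mem_chamber (hn : 0 < n) {x : Fin n → ℤ} (hx : x ∈ chamber n M)
    {σ : Equiv.Perm (Fin n)} (hσ : ∀ k, (M : ℤ) ∣ x k - (σ k : ℤ))
    (hsum : ∑ k, x k = ∑ k : Fin n, (k : ℤ)) : ∀ k, x k = σ k := by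
  rcases Nat.eq_zero_or_pos M with rfl | hM
  · intro k
    have := hσ k
    simp only [Nat.cast_zero, zero_dvd_iff] at this
    omega
  have hMZ : (0 : ℤ) < M := by exact_mod_cast hM
  choose v hv using hσ
  have hnM : n ≤ M := by
    have hlow : ∀ k : ℕ, ∀ hk : k < n, x ⟨0, hn⟩ + k ≤ x ⟨k, hk⟩ := by
      intro k
      induction k with
      | zero => intro hk; simp
      | succ k ih =>
        intro hk
        have h1 := ih (by omega)
        have h2 := (hx ⟨k, by omega⟩ ⟨k + 1, hk⟩ (by simp)).1
        push_cast
        omega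
    by_contra! hcon
    have h1 := hlow M hcon
    have h2 := (hx ⟨0, hn⟩ ⟨M, hcon⟩ (by simpa using hM)).2 hM.ne'
    omega
  have hσlt : ∀ k, (σ k : ℤ) < M := fun k => by have := (σ k).2; omega
  have hvsum : ∑ k, v k = 0 := by
    have h1 : ∑ k, (x k - (σ k : ℤ)) = M * ∑ k, v k := by
      rw [Finset.mul_sum]; exact Finset.sum_congr rfl fun k _ => hv k
    rw [Finset.sum_sub_distrib, Equiv.sum_comp σ fun k : Fin n => (k : ℤ), hsum, sub_self] at h1
    exact (mul_eq_zero.1 h1.symm).resolve_left hMZ.ne'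
  have hmono : ∀ i j, i < j → v i ≤ v j ∧ v j ≤ v i + 1 := by
    intro i j hij
    obtain ⟨h1, h2⟩ := hx i j hij
    have h2 := h2 hM.ne'
    have hi := hv i
    have hj := hv j
    have a := hσlt i
    have b := hσlt j
    -- `M * (v i - v j) < M` since `x i < x j`, and `M * (v j - v i) < 2 * M` since `x j < x i + M`.
    constructor <;> by_contra! hcon
    · nlinarith
    · nlinarith
  have hv0 : ∀ k, v ⟨0, hn⟩ ≤ v k ∧ v k ≤ v ⟨0, hn⟩ + 1 := by
    intro k
    rcases Nat.eq_zero_or_pos k with h | h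
    · have : k = ⟨0, hn⟩ := Fin.ext h
      simp [this]
    · exact hmono _ _ (Fin.lt_def.2 h)
  have hvz : ∀ k, v k = 0 := by
    have hnonneg : 0 ≤ v ⟨0, hn⟩ := by
      by_contra! hneg
      have : ∑ k, v k < ∑ _ : Fin n, 0 :=
        Finset.sum_lt_sum (fun k _ => by have := hv0 k; omega) ⟨⟨0, hn⟩, Finset.mem_univ _, hneg⟩
      simp [hvsum] at this
    intro k
    exact (Finset.sum_eq_zero_iff_of_nonneg fun k _ => hnonneg.trans (hv0 k).1).1 hvsum k
      (Finset.mem_univ k)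
  intro k
  have := hv k
  rw [hvz k] at this
  omega

open Classical in
theorem alternatingSum_of_mem_chamber (hn : 0 < n) {x : Fin n → ℤ} (hx : x ∈ chamber n M) :
    alternatingSum n M x = if x = fun i : Fin n => (i : ℤ) then 1 else 0 := by
  unfold alternatingSum
  have hiff : ∀ σ : Equiv.Perm (Fin n),
      ((∀ k, (M : ℤ) ∣ x k - (σ k : ℤ)) ∧ ∑ k, x k = ∑ k : Fin n, (k : ℤ)) ↔
        σ = 1 ∧ x = fun i : Fin n => (i : ℤ) := by
    intro σ
    constructor
    · rintro ⟨h1, h2⟩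
      have h := eq_of_mem_chamber hn hx h1 h2
      have hσ : σ = 1 := perm_eq_one_of_strictMono fun i j hij => by
        have := (hx i j hij).1
        rw [h, h] at this
        exact_mod_cast this
      refine ⟨hσ, funext fun k => ?_⟩
      simp [h k, hσ]
    · rintro ⟨rfl, rfl⟩
      simp
  simp only [hiff]
  rw [Finset.sum_eq_single 1 (fun σ _ hσ => by simp [hσ]) (by simp)]
  simp

end Chamber

/-! ### The reflection principle for the walkers -/

section NonIntersecting

variable {Ω : Type*} [MeasurableSpace Ω] {μ : Measure Ω} {n M : ℕ} {Y : Fin n → ℝ≥0 → Ω → ℤ}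

/-- The walkers stay in the alcove during `[0, T]` and return to their starting points. -/
def returnEvent (Y : Fin n → ℝ≥0 → Ω → ℤ) (M : ℕ) (T : ℝ≥0) : Set Ω :=
  {ω | (∀ t ≤ T, configuration Y t ω ∈ chamber n M) ∧
    configuration Y T ω = fun i : Fin n => (i : ℤ)}

omit [MeasurableSpace Ω] in
theorem configuration_zero (ω : Ω) : configuration Y 0 ω = fun i : Fin n => (i : ℤ) := by
  ext i; simp [configuration]

theorem measurableSet_forall_gridTime_mem (hY : ∀ i, IsSymmetricWalk μ (Y i)) (T : ℝ≥0)
    (C : Set (Fin n → ℤ)) :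
    MeasurableSet {ω | ∀ N j : ℕ, j ≤ 2 ^ N → configuration Y (gridTime T (2 ^ N) j) ω ∈ C} := by
  simp only [Set.ofPred_forall]
  exact .iInter fun N => .iInter fun j => .iInter fun _ =>
    measurable_configuration hY _ C.to_countable.measurableSet

theorem ae_forall_gridTime_mem_iff (hY : ∀ i, IsSymmetricWalk μ (Y i)) (T : ℝ≥0)
    (C : Set (Fin n → ℤ)) :
    ∀ᵐ ω ∂μ, (∀ N j : ℕ, j ≤ 2 ^ N → configuration Y (gridTime T (2 ^ N) j) ω ∈ C) ↔
      ∀ t ≤ T, configuration Y t ω ∈ C := by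
  filter_upwards [ae_all_iff.2 fun i => (hY i).cadlag] with ω hω
  exact forall_gridTime_mem_iff (fun i t => (hω i t).1) T C

theorem gridEvent_ae_eq_returnEvent (hY : ∀ i, IsSymmetricWalk μ (Y i)) (M : ℕ) (T : ℝ≥0) :
    ({ω | ∀ N j : ℕ, j ≤ 2 ^ N → configuration Y (gridTime T (2 ^ N) j) ω ∈ chamber n M} ∩
      {ω | configuration Y T ω = fun i : Fin n => (i : ℤ)} : Set Ω) =ᵐ[μ] returnEvent Y M T := by
  filter_upwards [ae_forall_gridTime_mem_iff hY T (chamber n M)] with ω hω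
  exact propext (and_congr_left' hω)

theorem nullMeasurableSet_returnEvent (hY : ∀ i, IsSymmetricWalk μ (Y i)) (M : ℕ) (T : ℝ≥0) :
    NullMeasurableSet (returnEvent Y M T) μ :=
  ((measurableSet_forall_gridTime_mem hY T _).inter
    (measurable_configuration hY T (measurableSet_singleton _))).nullMeasurableSet.congr
    (gridEvent_ae_eq_returnEvent hY M T)

variable [IsProbabilityMeasure μ]

/-- Exchanging the increments of the two congruent walkers preserves the law and negates the
integrand, so the integral equals its own negative. -/
theorem integral_alternatingSum_of_mem_walls (hY : ∀ i, IsSymmetricWalk μ (Y i))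
    (hindep : iIndepFun (fun i ω t => Y i t ω) μ) {s t : ℝ≥0} (hst : s ≤ t) {z : Fin n → ℤ}
    (hz : z ∈ walls n M) :
    ∫ ω, alternatingSum n M (fun i => z i + (Y i t ω - Y i s ω)) ∂μ = 0 := by
  obtain ⟨i, j, hij, hdvd⟩ := hz
  set τ := Equiv.swap i j
  set g : (Fin n → ℤ) → ℝ := fun v => alternatingSum n M (fun k => z k + v k)
  have hm : ∀ σ : Equiv.Perm (Fin n),
      AEMeasurable (fun ω k => Y (σ k) t ω - Y (σ k) s ω) μ := fun σ =>
    (measurable_pi_lambda _ fun k =>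
      ((hY (σ k)).measurable t).sub ((hY (σ k)).measurable s)).aemeasurable
  have hg : ∀ ν : Measure (Fin n → ℤ), AEStronglyMeasurable g ν := fun ν =>
    Measurable.of_discrete.aestronglyMeasurable
  have h1 : ∫ ω, g (fun k => Y (τ k) t ω - Y (τ k) s ω) ∂μ =
      ∫ ω, g (fun k => Y k t ω - Y k s ω) ∂μ := by
    rw [← integral_map (hm τ) (hg _), map_increment_perm hY hindep hst τ,
      integral_map (by simpa using hm 1) (hg _)]
  have h2 : ∀ ω, g (fun k => Y (τ k) t ω - Y (τ k) s ω) =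
      -g (fun k => Y k t ω - Y k s ω) := by
    intro ω
    refine alternatingSum_swap hij (fun k => ?_) ?_
    · have : z k + (Y (τ k) t ω - Y (τ k) s ω) - (z (τ k) + (Y (τ k) t ω - Y (τ k) s ω)) =
          z k - z (τ k) := by ring
      rw [this]
      rcases eq_or_ne k i with rfl | hki
      · simpa [τ] using hdvd
      rcases eq_or_ne k j with rfl | hkj
      · simpa [τ, dvd_sub_comm] using hdvd
      · simp [τ, Equiv.swap_apply_of_ne_of_ne hki hkj]
    · rw [Finset.sum_add_distrib, Finset.sum_add_distrib,
        Equiv.sum_comp τ fun k => Y k t ω - Y k s ω]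
  simp only [h2, integral_neg] at h1
  change ∫ ω, g (fun k => Y k t ω - Y k s ω) ∂μ = 0
  linarith

theorem measureReal_returnEvent (hn : 0 < n) (hY : ∀ i, IsSymmetricWalk μ (Y i))
    (hindep : iIndepFun (fun i ω t => Y i t ω) μ) (M : ℕ) (T : ℝ≥0) :
    μ.real (returnEvent Y M T) = ∫ ω, alternatingSum n M (configuration Y T ω) ∂μ := by
  by_cases h0 : (fun i : Fin n => (i : ℤ)) ∈ chamber n M
  · rw [← setIntegral_stay_eq_integral hY hindep abs_alternatingSum_le h0
      (fun x hx y => mem_chamber_union_walls_of_step hx)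
      (fun s t hst z hz => integral_alternatingSum_of_mem_walls hY hindep hst hz) T,
      ← measureReal_congr (gridEvent_ae_eq_returnEvent hY M T)]
    set G := {ω | ∀ N j : ℕ, j ≤ 2 ^ N → configuration Y (gridTime T (2 ^ N) j) ω ∈ chamber n M}
    have hG : MeasurableSet G := measurableSet_forall_gridTime_mem hY T _
    set R := {ω | configuration Y T ω = fun i : Fin n => (i : ℤ)}
    have hR : MeasurableSet R := measurable_configuration hY T (measurableSet_singleton _)
    have hcongr : ∫ ω in G, alternatingSum n M (configuration Y T ω) ∂μ =
        ∫ ω in G, R.indicator 1 ω ∂μ := by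
      refine setIntegral_congr_fun hG fun ω hω => ?_
      have hmem : configuration Y T ω ∈ chamber n M := by
        simpa [gridTime_self] using hω 0 1 (by simp)
      classical
      simp only [alternatingSum_of_mem_chamber hn hmem, R, Set.indicator_apply,
        Set.mem_ofPred_eq, Pi.one_apply]
    rw [hcongr, integral_indicator_one hR, measureReal_restrict_apply hR, Set.inter_comm]
  -- The remaining case is `0 < M < n`: the starting point already lies on a wall, and both sides
  -- are zero.
  · have hempty : returnEvent Y M T = ∅ := by
      ext ω
      simp only [returnEvent, Set.mem_ofPred_eq, Set.mem_empty_iff_false, iff_false, not_and]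
      intro h
      have := h 0 zero_le
      rw [configuration_zero] at this
      exact absurd this h0
    have hwall : (fun i : Fin n => (i : ℤ)) ∈ walls n M := by
      simp only [chamber, Set.mem_ofPred_eq, not_forall] at h0
      obtain ⟨i, j, hij, h⟩ := h0
      have hij' : (i : ℕ) < j := hij
      have hM : M ≠ 0 ∧ (i : ℕ) + M ≤ j := by
        by_contra hcon
        refine h ⟨by exact_mod_cast hij', fun hM => ?_⟩
        have : ¬ (i : ℕ) + M ≤ j := fun h => hcon ⟨hM, h⟩
        omega
      refine ⟨i, ⟨i + M, by have := j.2; omega⟩, fun he => ?_, by simp⟩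
      have := congrArg Fin.val he
      simp at this
      exact hM.1 this
    rw [hempty, measureReal_empty]
    exact (integral_alternatingSum_of_mem_walls hY hindep zero_le hwall).symm

/-- Each of the `n * m` independent increments vanishes with probability at least `e^{-T/m}`. The
resulting bound does not depend on `m`, so it survives refinement of the grid. -/
theorem exp_neg_le_measureReal_grid_constant (hY : ∀ i, IsSymmetricWalk μ (Y i))
    (hindep : iIndepFun (fun i ω t => Y i t ω) μ) (T : ℝ≥0) {m : ℕ} (hm : m ≠ 0) :
    Real.exp (-(n * T)) ≤ μ.real {ω | ∀ j ≤ m,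
      configuration Y (gridTime T m j) ω ∈ ({fun i : Fin n => (i : ℤ)} : Set (Fin n → ℤ))} := by
  have hmono := gridTime_mono T m
  have h := (iIndepFun_increments hY hindep hmono).measure_inter_preimage_eq_mul
    (Finset.univ ×ˢ Finset.range m) (sets := fun _ => {0}) (by simp)
  have h' := congrArg ENNReal.toReal h
  rw [ENNReal.toReal_prod] at h'
  have hprod : Real.exp (-(n * T)) ≤ ∏ p ∈ (Finset.univ : Finset (Fin n)) ×ˢ Finset.range m,
      (μ ((fun ω => Y p.1 (gridTime T m (p.2 + 1)) ω - Y p.1 (gridTime T m p.2) ω) ⁻¹'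
        {0})).toReal := by
    calc Real.exp (-(n * T)) = ∏ _p ∈ (Finset.univ : Finset (Fin n)) ×ˢ Finset.range m,
          Real.exp (-(T / m)) := by
          have : (m : ℝ) ≠ 0 := by exact_mod_cast hm
          rw [Finset.prod_const, Finset.card_product, Finset.card_univ, Fintype.card_fin,
            Finset.card_range, ← Real.exp_nat_mul]
          congr 1
          push_cast
          field_simp
      _ ≤ _ := by
          refine Finset.prod_le_prod (fun _ _ => (Real.exp_pos _).le) fun p _ => ?_
          have h1 := exp_neg_le_walkKernel_zero (gridTime T m (p.2 + 1) - gridTime T m p.2)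
          rw [← (hY p.1).measureReal_increment_eq (hmono p.2.le_succ), gridTime_succ_sub] at h1
          exact h1
  refine (hprod.trans_eq h'.symm).trans (measureReal_mono fun ω hω j hj => ?_)
  simp only [Set.mem_iInter, Set.mem_preimage, Set.mem_singleton_iff, Finset.mem_product,
    Finset.mem_univ, true_and, Finset.mem_range] at hω
  ext i
  have : Y i (gridTime T m j) ω - Y i (gridTime T m 0) ω = 0 := by
    rw [← Finset.sum_range_sub (fun j => Y i (gridTime T m j) ω)]
    refine Finset.sum_eq_zero fun l hl => hω (i, l) ?_
    have := Finset.mem_range.1 hl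
    omega
  rw [gridTime_zero] at this
  simp [configuration, this]

theorem measureReal_returnEvent_zero_pos (hY : ∀ i, IsSymmetricWalk μ (Y i))
    (hindep : iIndepFun (fun i ω t => Y i t ω) μ) (T : ℝ≥0) :
    0 < μ.real (returnEvent Y 0 T) := by
  set C : Set (Fin n → ℤ) := {fun i : Fin n => (i : ℤ)}
  set A : ℕ → Set Ω := fun N => {ω | ∀ j ≤ 2 ^ N, configuration Y (gridTime T (2 ^ N) j) ω ∈ C}
  have hA : ∀ N, MeasurableSet (A N) := fun N => by
    simp only [A, Set.ofPred_forall]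
    exact .iInter fun j => .iInter fun _ => measurable_configuration hY _ C.to_countable.measurableSet
  have hanti : Antitone A := antitone_nat_of_succ_le fun N ω hω j hj => by
    have := hω (2 * j) (by rw [pow_succ]; omega)
    rwa [pow_succ', gridTime_two_mul] at this
  have hlim : Tendsto (fun N => μ.real (A N)) atTop (𝓝 (μ.real (⋂ N, A N))) :=
    (ENNReal.tendsto_toReal (measure_ne_top _ _)).comp
      (tendsto_measure_iInter_atTop (fun N => (hA N).nullMeasurableSet) hanti
        ⟨0, measure_ne_top _ _⟩)
  have hle : Real.exp (-(n * T)) ≤ μ.real (⋂ N, A N) := ge_of_tendsto' hlim fun N =>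
    exp_neg_le_measureReal_grid_constant hY hindep T (by positivity)
  refine (Real.exp_pos _).trans_le (hle.trans ?_)
  refine ENNReal.toReal_mono (measure_ne_top _ _) (measure_mono_ae ?_)
  filter_upwards [ae_forall_gridTime_mem_iff hY T C] with ω hω hmem
  have h : ∀ t ≤ T, configuration Y t ω ∈ C := hω.1 fun N j hj => Set.mem_iInter.1 hmem N j hj
  refine ⟨fun t ht => ?_, h T le_rfl⟩
  rw [Set.mem_singleton_iff.1 (h t ht)]
  exact fun i j hij => ⟨Int.ofNat_lt.2 hij, fun h => absurd rfl h⟩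

/-! ### The conditioned walk and its width -/

omit [IsProbabilityMeasure μ] in
-- `configuration` subtracts `Y i 0`, which is zero only almost surely.
theorem nonIntersectingEvent_ae_eq (hY : ∀ i, IsSymmetricWalk μ (Y i)) (T : ℝ≥0) :
    nonIntersectingEvent Y T =ᵐ[μ] returnEvent Y 0 T := by
  filter_upwards [ae_all_iff.2 fun i => (hY i).start_zero] with ω hω
  refine propext ?_
  change ω ∈ nonIntersectingEvent Y T ↔ ω ∈ returnEvent Y 0 T
  simp only [nonIntersectingEvent, returnEvent, walker, configuration, chamber, hω,
    Set.mem_ofPred_eq, Set.mem_Icc, zero_le, true_and, funext_iff, sub_zero, ne_eq,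
    not_true_eq_false, false_imp_iff, and_true, add_comm, add_zero]
  exact and_comm

omit [MeasurableSpace Ω] in
theorem walkWidth_lt_iff (hn : 0 < n) {T : ℝ≥0} {ω : Ω} :
    walkWidth hn Y T ω < ((M : ℝ) : EReal) ↔ ∀ t ≤ T,
      walker Y ⟨n - 1, Nat.sub_lt hn Nat.one_pos⟩ t ω - walker Y ⟨0, hn⟩ t ω < M := by
  unfold walkWidth
  constructor
  · intro h t ht
    have h1 := (le_iSup₂ (f := fun t (_ : t ∈ Set.Icc 0 T) =>
      (((walker Y ⟨n - 1, Nat.sub_lt hn Nat.one_pos⟩ t ω - walker Y ⟨0, hn⟩ t ω : ℤ) : ℝ) :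
        EReal)) t ⟨zero_le, ht⟩).trans_lt h
    exact_mod_cast h1
  · intro h
    -- Integer widths below `M` are at most `M - 1`, which keeps the inequality strict after taking
    -- the supremum.
    have h1 : (((M : ℤ) - 1 : ℤ) : ℝ) < (M : ℝ) := by push_cast; linarith
    refine lt_of_le_of_lt (iSup₂_le fun t ht => ?_) (EReal.coe_lt_coe_iff.2 h1)
    exact EReal.coe_le_coe_iff.2 (Int.cast_le.2 (Int.le_sub_one_of_lt (h t ht.2)))

omit [MeasurableSpace Ω] in
theorem configuration_mem_chamber_iff (hn : 0 < n) (hM : 0 < M) {t : ℝ≥0} {ω : Ω} :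
    configuration Y t ω ∈ chamber n M ↔ configuration Y t ω ∈ chamber n 0 ∧
      configuration Y t ω ⟨n - 1, Nat.sub_lt hn Nat.one_pos⟩ - configuration Y t ω ⟨0, hn⟩ < M := by
  set x := configuration Y t ω
  constructor
  · refine fun h => ⟨fun i j hij => ⟨(h i j hij).1, by simp⟩, ?_⟩
    rcases Nat.eq_zero_or_pos (n - 1) with h0 | h0
    · simp only [h0, sub_self]
      exact_mod_cast hM
    · have := (h ⟨0, hn⟩ ⟨n - 1, by omega⟩ (Fin.lt_def.2 h0)).2 hM.ne'
      omega
  · rintro ⟨h, hw⟩ i j hij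
    refine ⟨(h i j hij).1, fun _ => ?_⟩
    have hmono : Monotone x := StrictMono.monotone fun i j hij => (h i j hij).1
    have h1 : x ⟨0, hn⟩ ≤ x i := hmono (Fin.le_def.2 (Nat.zero_le _))
    have h2 : x j ≤ x ⟨n - 1, Nat.sub_lt hn Nat.one_pos⟩ :=
      hmono (Fin.le_def.2 (Nat.le_sub_one_of_lt j.2))
    omega

omit [IsProbabilityMeasure μ] in
theorem nonIntersectingEvent_inter_width_ae_eq (hn : 0 < n) (hM : 0 < M)
    (hY : ∀ i, IsSymmetricWalk μ (Y i)) (T : ℝ≥0) :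
    (nonIntersectingEvent Y T ∩ {ω | walkWidth hn Y T ω < ((M : ℝ) : EReal)} : Set Ω) =ᵐ[μ]
      returnEvent Y M T := by
  filter_upwards [nonIntersectingEvent_ae_eq hY T, ae_all_iff.2 fun i => (hY i).start_zero]
    with ω hω h0
  refine propext ?_
  have hω' : ω ∈ nonIntersectingEvent Y T ↔ ω ∈ returnEvent Y 0 T := Iff.of_eq hω
  have hwalk : ∀ i t, walker Y i t ω = configuration Y t ω i := fun i t => by
    simp [walker, configuration, h0, add_comm]
  change ω ∈ nonIntersectingEvent Y T ∧ walkWidth hn Y T ω < ((M : ℝ) : EReal) ↔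
    ω ∈ returnEvent Y M T
  rw [hω', walkWidth_lt_iff]
  simp only [returnEvent, Set.mem_ofPred_eq, hwalk, configuration_mem_chamber_iff hn hM,
    imp_and, forall_and]
  tauto

theorem cond_width_eq (hn : 0 < n) (hM : 0 < M) (hY : ∀ i, IsSymmetricWalk μ (Y i))
    (hindep : iIndepFun (fun i ω t => Y i t ω) μ) (T : ℝ≥0) :
    (μ[|nonIntersectingEvent Y T]).real {ω | walkWidth hn Y T ω < ((M : ℝ) : EReal)} =
      (∫ ω, alternatingSum n 0 (configuration Y T ω) ∂μ)⁻¹ *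
        ∫ ω, alternatingSum n M (configuration Y T ω) ∂μ := by
  have hae := nonIntersectingEvent_ae_eq hY T
  -- The event involves uncountably many times; null measurability, obtained from the grid event,
  -- suffices for conditioning.
  have hnull : NullMeasurableSet (nonIntersectingEvent Y T) μ :=
    (nullMeasurableSet_returnEvent hY 0 T).congr hae.symm
  rw [← measureReal_returnEvent hn hY hindep, ← measureReal_returnEvent hn hY hindep,
    ← measureReal_congr hae,
    ← measureReal_congr (nonIntersectingEvent_inter_width_ae_eq hn hM hY T)]
  simp only [measureReal_def]
  rw [ProbabilityTheory.cond, Measure.smul_apply, Measure.restrict_apply₀' hnull, smul_eq_mul,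
    ENNReal.toReal_mul, ENNReal.toReal_inv, Set.inter_comm]

end NonIntersecting

/-! ### Fourier analysis on the circle -/

section Circle

theorem circleIntegral_div_eq (F : ℂ → ℂ) :
    (∮ s in C(0, 1), F s / (2 * Real.pi * Complex.I * s)) =
      (2 * Real.pi : ℂ)⁻¹ * ∫ θ in (0 : ℝ)..2 * Real.pi, F (circleMap 0 1 θ) := by
  rw [circleIntegral, ← intervalIntegral.integral_const_mul]
  refine intervalIntegral.integral_congr fun θ _ => ?_
  have h0 : circleMap 0 1 θ ≠ 0 := circleMap_ne_center one_ne_zero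
  have hpi : (Real.pi : ℂ) ≠ 0 := by exact_mod_cast Real.pi_ne_zero
  simp only [deriv_circleMap, smul_eq_mul]
  field_simp

theorem circleMap_zpow (θ : ℝ) (q : ℤ) :
    circleMap 0 1 θ ^ q = Complex.exp (q * Complex.I * θ) := by
  rw [circleMap_zero]
  simp only [Complex.ofReal_one, one_mul]
  rw [← Complex.exp_int_mul]
  ring_nf

theorem integral_circleMap_zpow (q : ℤ) :
    (2 * Real.pi : ℂ)⁻¹ * ∫ θ in (0 : ℝ)..2 * Real.pi, circleMap 0 1 θ ^ q =
      if q = 0 then 1 else 0 := by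
  have hpi : (Real.pi : ℂ) ≠ 0 := by exact_mod_cast Real.pi_ne_zero
  split_ifs with hq
  · subst hq
    simp only [zpow_zero, intervalIntegral.integral_const, sub_zero]
    rw [Complex.real_smul]
    push_cast
    field_simp
  · have hc : (q : ℂ) * Complex.I ≠ 0 :=
      mul_ne_zero (by exact_mod_cast hq) Complex.I_ne_zero
    simp only [circleMap_zpow]
    rw [integral_exp_mul_complex hc]
    have : (q : ℂ) * Complex.I * ((2 * Real.pi : ℝ) : ℂ) = q * (2 * Real.pi * Complex.I) := by
      push_cast; ring
    rw [this, Complex.exp_int_mul_two_pi_mul_I]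
    simp

variable {Ω : Type*} [MeasurableSpace Ω] {μ : Measure Ω} [IsProbabilityMeasure μ]

theorem integrable_indicator_circleMap_zpow {A : Set Ω} (hA : MeasurableSet A) {q : Ω → ℤ}
    (hq : Measurable q) :
    Integrable (fun p : ℝ × Ω => A.indicator (fun _ => (1 : ℂ)) p.2 * circleMap 0 1 p.1 ^ q p.2)
      ((volume.restrict (Set.uIoc 0 (2 * Real.pi))).prod μ) := by
  have hm : Measurable fun p : ℝ × Ω =>
      A.indicator (fun _ => (1 : ℂ)) p.2 * circleMap 0 1 p.1 ^ q p.2 := by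
    simp only [circleMap_zpow]
    have h1 : Measurable fun p : ℝ × Ω => A.indicator (fun _ => (1 : ℂ)) p.2 :=
      (measurable_const.indicator hA).comp measurable_snd
    have h2 : Measurable fun p : ℝ × Ω => ((q p.2 : ℤ) : ℂ) :=
      (Measurable.of_discrete (f := fun k : ℤ => (k : ℂ))).comp (hq.comp measurable_snd)
    have h3 : Measurable fun p : ℝ × Ω => (p.1 : ℂ) :=
      Complex.measurable_ofReal.comp measurable_fst
    exact h1.mul (Complex.measurable_exp.comp ((h2.mul_const _).mul h3))
  have : IsFiniteMeasure (volume.restrict (Set.uIoc 0 (2 * Real.pi))) :=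
    ⟨by simp [Set.uIoc, Real.volume_Ioc]⟩
  refine .of_bound hm.aestronglyMeasurable 1 (.of_forall fun p => ?_)
  rw [norm_mul, norm_zpow, norm_circleMap_zero, abs_one, one_zpow, mul_one]
  by_cases h : p.2 ∈ A <;> simp [h]

theorem intervalIntegrable_integral_circleMap_zpow {A : Set Ω} (hA : MeasurableSet A) {q : Ω → ℤ}
    (hq : Measurable q) :
    IntervalIntegrable
      (fun θ => ∫ ω, A.indicator (fun _ => (1 : ℂ)) ω * circleMap 0 1 θ ^ q ω ∂μ) volume 0
      (2 * Real.pi) := by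
  rw [intervalIntegrable_iff]
  exact (integrable_indicator_circleMap_zpow (μ := μ) hA hq).integral_prod_left

theorem integral_integral_circleMap_zpow {A : Set Ω} (hA : MeasurableSet A) {q : Ω → ℤ}
    (hq : Measurable q) :
    (2 * Real.pi : ℂ)⁻¹ * ∫ θ in (0 : ℝ)..2 * Real.pi,
      ∫ ω, A.indicator (fun _ => (1 : ℂ)) ω * circleMap 0 1 θ ^ q ω ∂μ =
      ∫ ω, A.indicator (fun _ => (1 : ℂ)) ω * (if q ω = 0 then 1 else 0) ∂μ := by
  have hint := integrable_indicator_circleMap_zpow (μ := μ) hA hq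
  rw [Set.uIoc_of_le Real.two_pi_pos.le] at hint
  rw [intervalIntegral.integral_of_le Real.two_pi_pos.le, integral_integral_swap hint,
    ← integral_const_mul]
  congr 1
  ext ω
  rw [← integral_circleMap_zpow, intervalIntegral.integral_of_le Real.two_pi_pos.le,
    integral_const_mul]
  ring

end Circle

/-! ### Averages over the roots of `z ^ M = s` -/

section Roots

theorem rootSet_card_ne_zero {M : ℕ} (hM : 0 < M) (s : ℂ) : (rootSet M s).card ≠ 0 := by
  obtain ⟨z, hz⟩ := IsAlgClosed.exists_pow_nat_eq s hM
  exact Finset.card_ne_zero_of_mem ((mem_rootSet hM).2 hz)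

theorem rootSet_average_zpow {M : ℕ} (hM : 0 < M) {s : ℂ} (hs : s ≠ 0) (N : ℤ) :
    (1 / ((rootSet M s).card : ℂ)) * ∑ z ∈ rootSet M s, z ^ N =
      if (M : ℤ) ∣ N then s ^ (N / M) else 0 := by
  have hcard : ((rootSet M s).card : ℂ) ≠ 0 := by exact_mod_cast rootSet_card_ne_zero hM s
  split_ifs with hN
  · obtain ⟨q, rfl⟩ := hN
    rw [Int.mul_ediv_cancel_left _ (by exact_mod_cast hM.ne'),
      Finset.sum_congr rfl fun z hz => by
        rw [zpow_mul, zpow_natCast, (mem_rootSet hM).1 hz],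
      Finset.sum_const, nsmul_eq_mul]
    field_simp
  · set ζ := Complex.exp (2 * Real.pi * Complex.I / M)
    have hζ : IsPrimitiveRoot ζ M := Complex.isPrimitiveRoot_exp M hM.ne'
    have hζ0 : ζ ≠ 0 := Complex.exp_ne_zero _
    -- Rotation by `ζ` permutes the roots, so the power sum vanishes unless `ζ ^ N = 1`.
    have hsum : ∑ z ∈ rootSet M s, z ^ N = ζ ^ N * ∑ z ∈ rootSet M s, z ^ N := by
      rw [Finset.mul_sum]
      refine Finset.sum_bij' (fun z _ => ζ⁻¹ * z) (fun z _ => ζ * z) ?_ ?_ ?_ ?_ ?_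
      · intro z hz
        rw [mem_rootSet hM] at hz ⊢
        rw [mul_pow, inv_pow, hζ.pow_eq_one, hz, inv_one, one_mul]
      · intro z hz
        rw [mem_rootSet hM] at hz ⊢
        rw [mul_pow, hζ.pow_eq_one, hz, one_mul]
      · intro z _
        rw [mul_inv_cancel_left₀ hζ0]
      · intro z _
        rw [inv_mul_cancel_left₀ hζ0]
      · intro z _
        rw [← mul_zpow, mul_inv_cancel_left₀ hζ0]
    have hne : ζ ^ N ≠ 1 := fun h => hN ((hζ.zpow_eq_one_iff_dvd N).1 h)
    have : (1 - ζ ^ N) * ∑ z ∈ rootSet M s, z ^ N = 0 := by linear_combination hsum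
    rw [(mul_eq_zero.1 this).resolve_left (sub_ne_zero.2 hne.symm), mul_zero]

end Roots

/-! ### Toeplitz determinants as alternating expectations -/

section Toeplitz

theorem zpow_finsetSum {ι : Type*} {s : ℂ} (hs : s ≠ 0) (t : Finset ι) (q : ι → ℤ) :
    s ^ (∑ k ∈ t, q k) = ∏ k ∈ t, s ^ q k := by
  classical
  induction t using Finset.induction_on with
  | empty => simp
  | insert a t ha ih => rw [Finset.sum_insert ha, Finset.prod_insert ha, zpow_add₀ hs, ih]

variable {Ω : Type*} [MeasurableSpace Ω] {μ : Measure Ω} [IsProbabilityMeasure μ] {n M : ℕ}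
  {Y : Fin n → ℝ≥0 → Ω → ℤ}

theorem IsSymmetricWalk.integrable_zpow {X : ℝ≥0 → Ω → ℤ} (hX : IsSymmetricWalk μ X) (T : ℝ≥0)
    {z : ℂ} (hz : ‖z‖ = 1) (k : ℤ) : Integrable (fun ω => z ^ (k + (X T ω - X 0 ω))) μ := by
  have hm : Measurable fun ω => z ^ (k + (X T ω - X 0 ω)) :=
    (Measurable.of_discrete (f := fun y : ℤ => z ^ (k + y))).comp
      ((hX.measurable T).sub (hX.measurable 0))
  exact .of_bound hm.aestronglyMeasurable 1 (.of_forall fun ω => by simp [hz])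

/-- The generating function of the kernel is the characteristic function of the increment. This lets
every entry of the determinants be read as an expectation. -/
theorem IsSymmetricWalk.walkSymbol_eq {X : ℝ≥0 → Ω → ℤ} (hX : IsSymmetricWalk μ X) (T : ℝ≥0)
    {z : ℂ} (hz : ‖z‖ = 1) :
    walkSymbol T z = Complex.exp ((T : ℝ) : ℂ) * ∫ ω, z ^ (X T ω - X 0 ω) ∂μ := by
  have hz0 : z ≠ 0 := by rintro rfl; simp at hz
  have hD : Measurable fun ω => X T ω - X 0 ω := (hX.measurable T).sub (hX.measurable 0)
  have hg : Measurable fun y : ℤ => z ^ y := Measurable.of_discrete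
  have : IsProbabilityMeasure (μ.map fun ω => X T ω - X 0 ω) :=
    Measure.isProbabilityMeasure_map hD.aemeasurable
  have hint : Integrable (fun y : ℤ => z ^ y) (μ.map fun ω => X T ω - X 0 ω) :=
    .of_bound hg.aestronglyMeasurable 1 (.of_forall fun ω => by simp [hz])
  rw [← integral_map (f := fun y : ℤ => z ^ y) hD.aemeasurable hg.aestronglyMeasurable,
    integral_countable hint]
  have h : ∀ y : ℤ, (μ.map fun ω => X T ω - X 0 ω).real {y} • z ^ y = walkKernel T y * z ^ y := by
    intro y
    rw [map_measureReal_apply hD (measurableSet_singleton y), Complex.real_smul]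
    congr 2
    have h := hX.measureReal_increment_eq (s := 0) (t := T) zero_le y
    rwa [tsub_zero] at h
  simp only [h]
  rw [(hasSum_walkKernel T hz0).tsum_eq, ← mul_assoc, ← Complex.exp_add]
  simp

omit [IsProbabilityMeasure μ] in
-- Column `k` involves only walker `k`, so in the Leibniz expansion independence turns each product
-- of expectations into the expectation of a product.
theorem det_expectation_eq (hY : ∀ i, IsSymmetricWalk μ (Y i))
    (hindep : iIndepFun (fun i ω t => Y i t ω) μ) (T : ℝ≥0) (H : ℤ → ℂ) :
    Matrix.det (Matrix.of fun j k : Fin n =>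
      Complex.exp ((T : ℝ) : ℂ) * ∫ ω, H (configuration Y T ω k - (j : ℤ)) ∂μ) =
    Complex.exp ((T : ℝ) : ℂ) ^ n * ∑ σ : Equiv.Perm (Fin n), ((Equiv.Perm.sign σ : ℤ) : ℂ) *
      ∫ ω, ∏ k, H (configuration Y T ω k - (σ k : ℤ)) ∂μ := by
  rw [Matrix.det_apply', Finset.mul_sum]
  refine Finset.sum_congr rfl fun σ _ => ?_
  have h := (iIndepFun_increment hindep 0 T).integral_fun_prod_comp
    (f := fun (k : Fin n) y => H ((k : ℤ) + y - (σ k : ℤ)))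
    (fun k => (((hY k).measurable T).sub ((hY k).measurable 0)).aemeasurable)
    (fun k => Measurable.of_discrete.aestronglyMeasurable)
  simp only [Matrix.of_apply, configuration]
  rw [h, Finset.prod_mul_distrib, Finset.prod_const, Finset.card_univ, Fintype.card_fin]
  ring

/-- Root averaging leaves `s` to the winding number of each walker relative to `σ`; the product over
walkers carries the total winding. -/
theorem discreteToeplitz_walkSymbol (hM : 0 < M) (hY : ∀ i, IsSymmetricWalk μ (Y i))
    (hindep : iIndepFun (fun i ω t => Y i t ω) μ) (T : ℝ≥0) {s : ℂ} (hs : ‖s‖ = 1) :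
    discreteToeplitz n (walkSymbol T) (rootSet M s) =
      Complex.exp ((T : ℝ) : ℂ) ^ n * ∑ σ : Equiv.Perm (Fin n), ((Equiv.Perm.sign σ : ℤ) : ℂ) *
        ∫ ω, {ω | ∀ k, (M : ℤ) ∣ configuration Y T ω k - (σ k : ℤ)}.indicator (fun _ => (1 : ℂ)) ω *
          s ^ (∑ k, (configuration Y T ω k - (σ k : ℤ)) / M) ∂μ := by
  have hs0 : s ≠ 0 := by rintro rfl; simp at hs
  have hz : ∀ z ∈ rootSet M s, ‖z‖ = 1 := fun z hz => by
    have h := congrArg norm ((mem_rootSet hM).1 hz)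
    rw [norm_pow, hs] at h
    exact (pow_eq_one_iff_of_nonneg (norm_nonneg z) hM.ne').1 h
  have hentry : ∀ j k : Fin n, (1 / ((rootSet M s).card : ℂ)) *
      ∑ z ∈ rootSet M s, z ^ (-(j : ℤ) + (k : ℤ)) * walkSymbol T z =
      Complex.exp ((T : ℝ) : ℂ) * ∫ ω, (fun N : ℤ => if (M : ℤ) ∣ N then s ^ (N / M) else 0)
        (configuration Y T ω k - (j : ℤ)) ∂μ := by
    intro j k
    have h1 : ∀ z ∈ rootSet M s, z ^ (-(j : ℤ) + (k : ℤ)) * walkSymbol T z =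
        Complex.exp ((T : ℝ) : ℂ) * ∫ ω, z ^ (-(j : ℤ) + k + (Y k T ω - Y k 0 ω)) ∂μ := by
      intro z hz'
      have hz0 : z ≠ 0 := by
        intro h
        have := hz z hz'
        simp [h] at this
      rw [(hY k).walkSymbol_eq T (hz z hz'), mul_left_comm, ← integral_const_mul]
      simp only [zpow_add₀ hz0]
    rw [Finset.sum_congr rfl h1, ← Finset.mul_sum, mul_left_comm,
      ← integral_finsetSum _ fun z hz' => (hY k).integrable_zpow T (hz z hz') _,
      ← integral_const_mul]
    congr 2
    ext ω
    rw [rootSet_average_zpow hM hs0]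
    have : -(j : ℤ) + k + (Y k T ω - Y k 0 ω) = configuration Y T ω k - (j : ℤ) := by
      simp only [configuration]; ring
    rw [this]
  rw [discreteToeplitz]
  rw [funext fun j => funext fun k => hentry j k,
    det_expectation_eq hY hindep T fun N : ℤ => if (M : ℤ) ∣ N then s ^ (N / M) else 0]
  congr 1
  refine Finset.sum_congr rfl fun σ _ => ?_
  congr 2
  ext ω
  by_cases h : ∀ k, (M : ℤ) ∣ configuration Y T ω k - (σ k : ℤ)
  · rw [Set.indicator_of_mem (by exact h), one_mul, Finset.prod_congr rfl fun k _ => if_pos (h k)]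
    exact (zpow_finsetSum hs0 _ _).symm
  · rw [Set.indicator_of_notMem (by exact h), zero_mul]
    obtain ⟨k, hk⟩ := not_forall.1 h
    exact Finset.prod_eq_zero (Finset.mem_univ k) (if_neg hk)

end Toeplitz

/-! ### Integration over `s` and comparison with the alternating sums -/

section Toeplitz

variable {Ω : Type*} [MeasurableSpace Ω] {μ : Measure Ω} [IsProbabilityMeasure μ] {n M : ℕ}
  {Y : Fin n → ℝ≥0 → Ω → ℤ}

theorem integral_alternatingSum_eq (T : ℝ≥0) (hY : ∀ i, IsSymmetricWalk μ (Y i))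
    (g : Equiv.Perm (Fin n) → Ω → ℂ)
    (hg : ∀ σ ω, ((∀ k, (M : ℤ) ∣ configuration Y T ω k - (σ k : ℤ)) ∧
      ∑ k, configuration Y T ω k = ∑ k : Fin n, (k : ℤ)) ∧ g σ ω = 1 ∨
      ¬ ((∀ k, (M : ℤ) ∣ configuration Y T ω k - (σ k : ℤ)) ∧
      ∑ k, configuration Y T ω k = ∑ k : Fin n, (k : ℤ)) ∧ g σ ω = 0) :
    ((∫ ω, alternatingSum n M (configuration Y T ω) ∂μ : ℝ) : ℂ) =
      ∑ σ : Equiv.Perm (Fin n), ((Equiv.Perm.sign σ : ℤ) : ℂ) * ∫ ω, g σ ω ∂μ := by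
  classical
  have hterm : ∀ σ ω, g σ ω = ((if (∀ k, (M : ℤ) ∣ configuration Y T ω k - (σ k : ℤ)) ∧
      ∑ k, configuration Y T ω k = ∑ k : Fin n, (k : ℤ) then 1 else 0 : ℝ) : ℂ) := by
    intro σ ω
    rcases hg σ ω with ⟨h1, h2⟩ | ⟨h1, h2⟩ <;> simp [h1, h2]
  simp only [hterm, integral_complex_ofReal, alternatingSum]
  rw [integral_finsetSum]
  · push_cast
    refine Finset.sum_congr rfl fun σ _ => ?_
    rw [integral_const_mul]
    push_cast
    rfl
  · intro σ _
    have hm : Measurable fun ω => ((Equiv.Perm.sign σ : ℤ) : ℝ) *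
        (if (∀ k, (M : ℤ) ∣ configuration Y T ω k - (σ k : ℤ)) ∧
          ∑ k, configuration Y T ω k = ∑ k : Fin n, (k : ℤ) then (1 : ℝ) else 0) :=
      (Measurable.of_discrete (f := fun x : Fin n → ℤ => ((Equiv.Perm.sign σ : ℤ) : ℝ) *
        (if (∀ k, (M : ℤ) ∣ x k - (σ k : ℤ)) ∧
          ∑ k, x k = ∑ k : Fin n, (k : ℤ) then (1 : ℝ) else 0))).comp
        (measurable_configuration hY T)
    refine .of_bound hm.aestronglyMeasurable 1 (.of_forall fun ω => ?_)
    rcases Int.units_eq_one_or (Equiv.Perm.sign σ) with h | h <;> rw [h] <;> split_ifs <;> simp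

/-- The case `M = 0`: integrating over the circle forces `x k = σ k` exactly, and the sum condition
in `alternatingSum` is then automatic. -/
theorem continuousToeplitz_walkSymbol (hY : ∀ i, IsSymmetricWalk μ (Y i))
    (hindep : iIndepFun (fun i ω t => Y i t ω) μ) (T : ℝ≥0) :
    continuousToeplitz n (walkSymbol T) = Complex.exp ((T : ℝ) : ℂ) ^ n *
      ((∫ ω, alternatingSum n 0 (configuration Y T ω) ∂μ : ℝ) : ℂ) := by
  have hentry : ∀ j k : Fin n, (∮ z in C(0, 1), z ^ (-(j : ℤ) + (k : ℤ)) * walkSymbol T z /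
      (2 * Real.pi * Complex.I * z)) =
      Complex.exp ((T : ℝ) : ℂ) * ∫ ω, (fun N : ℤ => if N = 0 then (1 : ℂ) else 0)
        (configuration Y T ω k - (j : ℤ)) ∂μ := by
    intro j k
    rw [circleIntegral_div_eq fun z => z ^ (-(j : ℤ) + (k : ℤ)) * walkSymbol T z]
    have hq : Measurable fun ω => configuration Y T ω k - (j : ℤ) :=
      ((measurable_pi_apply k).comp (measurable_configuration hY T)).sub_const _
    have h := integral_integral_circleMap_zpow (μ := μ) MeasurableSet.univ hq
    simp only [Set.indicator_univ, one_mul] at h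
    rw [← h, mul_left_comm, ← intervalIntegral.integral_const_mul (Complex.exp ((T : ℝ) : ℂ))]
    congr 1
    refine intervalIntegral.integral_congr fun θ _ => ?_
    have hθ : ‖circleMap 0 1 θ‖ = 1 := by simp
    have hθ0 : circleMap 0 1 θ ≠ 0 := circleMap_ne_center one_ne_zero
    rw [(hY k).walkSymbol_eq T hθ, mul_left_comm, ← integral_const_mul]
    congr 2
    ext ω
    rw [← zpow_add₀ hθ0]
    congr 1
    simp only [configuration]
    ring
  rw [continuousToeplitz, funext fun j => funext fun k => hentry j k,
    det_expectation_eq hY hindep T fun N : ℤ => if N = 0 then (1 : ℂ) else 0,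
    integral_alternatingSum_eq T hY]
  intro σ ω
  by_cases h : ∀ k, ((0 : ℕ) : ℤ) ∣ configuration Y T ω k - (σ k : ℤ)
  · refine Or.inl ⟨⟨h, ?_⟩, Finset.prod_eq_one fun k _ => if_pos (by simpa using h k)⟩
    rw [← Equiv.sum_comp σ fun k : Fin n => (k : ℤ)]
    refine Finset.sum_congr rfl fun k _ => ?_
    have := h k
    simp only [Nat.cast_zero, zero_dvd_iff] at this
    omega
  · refine Or.inr ⟨fun h' => h h'.1, ?_⟩
    obtain ⟨k, hk⟩ := not_forall.1 h
    exact Finset.prod_eq_zero (Finset.mem_univ k) (if_neg (by simpa using hk))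

omit [IsProbabilityMeasure μ] in
theorem measurableSet_dvd_configuration (hY : ∀ i, IsSymmetricWalk μ (Y i)) (M : ℕ) (T : ℝ≥0)
    (σ : Equiv.Perm (Fin n)) :
    MeasurableSet {ω | ∀ k, (M : ℤ) ∣ configuration Y T ω k - (σ k : ℤ)} :=
  measurable_configuration hY T
    (Set.to_countable {x : Fin n → ℤ | ∀ k, (M : ℤ) ∣ x k - (σ k : ℤ)}).measurableSet

omit [IsProbabilityMeasure μ] in
theorem measurable_sum_ediv_configuration (hY : ∀ i, IsSymmetricWalk μ (Y i)) (M : ℕ) (T : ℝ≥0)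
    (σ : Equiv.Perm (Fin n)) :
    Measurable fun ω => ∑ k, (configuration Y T ω k - (σ k : ℤ)) / (M : ℤ) :=
  (Measurable.of_discrete (f := fun x : Fin n → ℤ => ∑ k, (x k - (σ k : ℤ)) / (M : ℤ))).comp
    (measurable_configuration hY T)

theorem circleIntegrable_discreteToeplitz (hM : 0 < M) (hY : ∀ i, IsSymmetricWalk μ (Y i))
    (hindep : iIndepFun (fun i ω t => Y i t ω) μ) (T : ℝ≥0) :
    CircleIntegrable (fun s => discreteToeplitz n (walkSymbol T) (rootSet M s) /
      (2 * Real.pi * Complex.I * s)) 0 1 := by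
  have h : IntervalIntegrable
      (fun θ => discreteToeplitz n (walkSymbol T) (rootSet M (circleMap 0 1 θ))) volume 0
      (2 * Real.pi) := by
    simp only [discreteToeplitz_walkSymbol hM hY hindep T
      (show ‖circleMap 0 1 _‖ = 1 by simp)]
    refine IntervalIntegrable.const_mul ?_ _
    rw [← Finset.sum_fn]
    refine IntervalIntegrable.sum _ fun σ _ => ?_
    exact (intervalIntegrable_integral_circleMap_zpow (measurableSet_dvd_configuration hY M T σ)
      (measurable_sum_ediv_configuration hY M T σ)).const_mul _
  have hcont : Continuous fun θ : ℝ => (2 * Real.pi * Complex.I * circleMap 0 1 θ)⁻¹ := by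
    refine Continuous.inv₀ (by fun_prop) fun θ => ?_
    exact mul_ne_zero Complex.two_pi_I_ne_zero (circleMap_ne_center one_ne_zero)
  simpa only [CircleIntegrable, div_eq_mul_inv] using h.mul_continuousOn hcont.continuousOn

/-- The integral over `s` keeps total winding zero. Given the congruences `x k ≡ σ k`, this is the
condition `∑ x k = ∑ k`, because `M` times the total winding is the difference of the two sums. -/
theorem circleIntegral_discreteToeplitz (hM : 0 < M) (hY : ∀ i, IsSymmetricWalk μ (Y i))
    (hindep : iIndepFun (fun i ω t => Y i t ω) μ) (T : ℝ≥0) :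
    (∮ s in C(0, 1), discreteToeplitz n (walkSymbol T) (rootSet M s) /
      (2 * Real.pi * Complex.I * s)) = Complex.exp ((T : ℝ) : ℂ) ^ n *
      ((∫ ω, alternatingSum n M (configuration Y T ω) ∂μ : ℝ) : ℂ) := by
  rw [circleIntegral_div_eq fun s => discreteToeplitz n (walkSymbol T) (rootSet M s)]
  simp only [discreteToeplitz_walkSymbol hM hY hindep T
    (show ‖circleMap 0 1 _‖ = 1 by simp)]
  rw [intervalIntegral.integral_const_mul, intervalIntegral.integral_finsetSum, mul_left_comm,
    Finset.mul_sum, integral_alternatingSum_eq T hY fun σ ω =>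
      {ω | ∀ k, (M : ℤ) ∣ configuration Y T ω k - (σ k : ℤ)}.indicator (fun _ => (1 : ℂ)) ω *
        (if ∑ k, (configuration Y T ω k - (σ k : ℤ)) / (M : ℤ) = 0 then 1 else 0)]
  · congr 1
    refine Finset.sum_congr rfl fun σ _ => ?_
    rw [intervalIntegral.integral_const_mul, mul_left_comm,
      integral_integral_circleMap_zpow (measurableSet_dvd_configuration hY M T σ)
        (measurable_sum_ediv_configuration hY M T σ)]
  · intro σ ω
    by_cases h : ∀ k, (M : ℤ) ∣ configuration Y T ω k - (σ k : ℤ)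
    · have hsum : (M : ℤ) * ∑ k, (configuration Y T ω k - (σ k : ℤ)) / (M : ℤ) =
          ∑ k, configuration Y T ω k - ∑ k : Fin n, (k : ℤ) := by
        rw [Finset.mul_sum, Finset.sum_congr rfl fun k _ => Int.mul_ediv_cancel' (h k),
          Finset.sum_sub_distrib, Equiv.sum_comp σ fun k : Fin n => (k : ℤ)]
      have hiff : ∑ k, (configuration Y T ω k - (σ k : ℤ)) / (M : ℤ) = 0 ↔
          ∑ k, configuration Y T ω k = ∑ k : Fin n, (k : ℤ) := by
        rw [← sub_eq_zero (a := ∑ k, configuration Y T ω k), ← hsum, mul_eq_zero]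
        simp [hM.ne']
      rw [Set.indicator_of_mem (by exact h), one_mul]
      by_cases h' : ∑ k, configuration Y T ω k = ∑ k : Fin n, (k : ℤ)
      · exact Or.inl ⟨⟨h, h'⟩, if_pos (hiff.2 h')⟩
      · exact Or.inr ⟨fun h'' => h' h''.2, if_neg (hiff.not.2 h')⟩
    · rw [Set.indicator_of_notMem (by exact h), zero_mul]
      exact Or.inr ⟨fun h' => h h'.1, rfl⟩
  · intro σ _
    exact (intervalIntegrable_integral_circleMap_zpow (measurableSet_dvd_configuration hY M T σ)
      (measurable_sum_ediv_configuration hY M T σ)).const_mul _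

end Toeplitz

theorem proposition2 {Ω : Type*} [MeasurableSpace Ω] (μ : Measure Ω) [IsProbabilityMeasure μ]
    (n : ℕ) (hn : 0 < n) (M : ℕ) (hM : 0 < M) (T : ℝ≥0)
    (Y : Fin n → ℝ≥0 → Ω → ℤ)
    (hY : ∀ i, IsSymmetricWalk μ (Y i))
    (hindep : iIndepFun (fun i ω t => Y i t ω) μ) :
    μ (nonIntersectingEvent Y T) ≠ 0 ∧
    continuousToeplitz n (walkSymbol T) ≠ 0 ∧
    CircleIntegrable (fun s => discreteToeplitz n (walkSymbol T) (rootSet M s) /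
      (2 * Real.pi * Complex.I * s)) 0 1 ∧
    (((μ[|nonIntersectingEvent Y T]).real {ω | walkWidth hn Y T ω < ((M : ℝ) : EReal)} : ℝ) : ℂ) =
      1 / continuousToeplitz n (walkSymbol T) *
        ∮ s in C(0, 1), discreteToeplitz n (walkSymbol T) (rootSet M s) /
          (2 * Real.pi * Complex.I * s) := by
  have hpos := measureReal_returnEvent_zero_pos hY hindep T
  have hint : (∫ ω, alternatingSum n 0 (configuration Y T ω) ∂μ) ≠ 0 := by
    rw [← measureReal_returnEvent hn hY hindep]
    exact hpos.ne'
  have hexp : Complex.exp ((T : ℝ) : ℂ) ^ n ≠ 0 := pow_ne_zero _ (Complex.exp_ne_zero _)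
  refine ⟨fun h => hpos.ne' ?_, ?_, circleIntegrable_discreteToeplitz hM hY hindep T, ?_⟩
  · rw [← measureReal_congr (nonIntersectingEvent_ae_eq hY T), measureReal_def, h,
      ENNReal.toReal_zero]
  · rw [continuousToeplitz_walkSymbol hY hindep]
    exact mul_ne_zero hexp (Complex.ofReal_ne_zero.2 hint)
  · rw [cond_width_eq hn hM hY hindep, continuousToeplitz_walkSymbol hY hindep,
      circleIntegral_discreteToeplitz hM hY hindep]
    have hint' := Complex.ofReal_ne_zero.2 hint
    rw [Complex.ofReal_mul, Complex.ofReal_inv]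
    field_simp
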